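/- Write $\widehat{\mathbb C}=\mathbb C\cup\{\infty\}$, and let $S'$ denote the complement of $S$ in $\widehat{\mathbb C}$. A function $h$ is analytic at $\infty$ if $w\mapsto h(w^{-1})$ is analytic at $0$. Let $R>1$, and let $B_R=\{\tfrac12(\zeta+\zeta^{-1}) : 1\le|\zeta|<R\}$ be the open interior of the Bernstein ellipse with parameter $R$. Let $E=[-1,1]$, let $D$ be a compact metric space, and let $F\subset\widehat{\mathbb C}$ be a closed set with $F\cap B_R=\emptyset$. Let $\lambda,\mu$ be finite Borel measures on $D$ and $E$, and let $\nu$ be a Borel measure on $F$. Let $K\in C(D\times[-1,1])$ be a complex-valued kernel which extends to a function $K\in C(D\times F')$ such that $K(x,\cdot)$ is analytic on $F'$ for every $x\in D$ (in particular, on $B_R$). A kernel $L\in C(D\times[-1,1])$ defines the operator $\mathcal L:L^2_\mu(-1,1)\to L^2_\lambda(D)$, $\mathcal L[g](x)=\int_{-1}^1 L(x,y)g(y)\,\mathrm d\mu(y)$, and its rank is the dimension of the range of $\mathcal L$. The Cauchy transform is $\mathcal C[g](z)=\int_{-1}^1\frac{g(y)}{y-z}\,\mathrm d\mu(y)$ for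 $z\in F$ (with value $0$ at $z=\infty$). Let $H(F)$ be the space of functions $h$ that are analytic on some open set $U\supset F$ of $\widehat{\mathbb C}$, with $h(\infty)=0$ if $\infty\in F$. For $1\le p\le\infty$ let $H^p_\nu(F)$ be the closure in $L^p_\nu(F)$ of $H(F)\cap L^p_\nu(F)$, and let $\mathcal K':H^p_\nu(F)\to L^2_\lambda(D)$ be the continuous extension, if it exists, of $$\mathcal K'[h](x)=\frac1{2\pi\mathrm i}\int_\Gamma K(x,\xi)h(\xi)\,\mathrm d\xi,\qquad h\in H(F)\cap L^p_\nu(F),$$ where $U$ is taken disjoint from $[-1,1]$ and with $\infty\notin U$ unless $\infty\in F$, and $\Gamma\subset U\setminus F$ is any finite sum of oriented rectifiable Jordan curves with $\mathrm{Ind}_\Gamma(F)-\mathrm{Ind}_\Gamma(U')=1$ (and $\mathrm{Ind}_\Gamma(\infty)=0$). If $\mathcal C$ does not map $L^2_\mu(-1,1)$ boundedly to $L^p_\nu(F)$, or the extension $\mathcal K'$ does not exist, the corresponding norm is $\infty$. Then for every $n=1,2,\dots$ there is a kernel $K_n\in C(D\times[-1,1])$ of rank at most $n$ such that, for every $p\in[1,\infty]$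 for which the two norms on the right are finite, $$\|\mathcal K-\mathcal K_n\|_{L^2_\mu(-1,1)\to L^2_\lambda(D)}\le\frac{2R^{-n}}{1-R^{-2n}}\,\|\mathcal C\|_{L^2_\mu(-1,1)\to L^p_\nu(F)}\,\|\mathcal K'\|_{H^p_\nu(F)\to L^2_\lambda(D)}.$$ -/

import Mathlib

open MeasureTheory Set
open scoped ENNReal

noncomputable section

namespace LowRank

/-! ### Integral operators with continuous kernel -/

section KernelOperator

variable {D E : Type*} [TopologicalSpace D] [CompactSpace D]
  [TopologicalSpace E] [CompactSpace E] [SecondCountableTopology E]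
  [MeasurableSpace E] [BorelSpace E]

theorem integral_kernel_eq_inner (μ : Measure E) [IsFiniteMeasure μ] (K : C(D × E, ℂ))
    (g : Lp ℂ 2 μ) (x : D) :
    ∫ y, K (x, y) * g y ∂μ = inner ℂ (ContinuousMap.toLp 2 μ ℂ (star (K.curry x))) g := by
  rw [L2.inner_def]
  refine integral_congr_ae ?_
  filter_upwards [ContinuousMap.coeFn_toLp (p := 2) (𝕜 := ℂ) μ (star (K.curry x))] with y hy
  rw [hy]
  simp [mul_comm]

theorem continuous_integral_kernel (μ : Measure E) [IsFiniteMeasure μ] (K : C(D × E, ℂ))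
    (g : Lp ℂ 2 μ) : Continuous fun x : D => ∫ y, K (x, y) * g y ∂μ := by
  simp_rw [integral_kernel_eq_inner]
  have h : Continuous fun x : D => star (K.curry x) := K.curry.continuous.star
  exact ((ContinuousMap.toLp 2 μ ℂ).continuous.comp h).inner continuous_const

/-- The map `g ↦ (x ↦ ∫ K(x, y) g(y) dμ(y))`, as a bounded operator from `L²(μ)` to `C(D)`. -/
def kernelOpC (μ : Measure E) [IsFiniteMeasure μ] (K : C(D × E, ℂ)) :
    Lp ℂ 2 μ →L[ℂ] C(D, ℂ) :=
  LinearMap.mkContinuous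
    { toFun := fun g => ⟨fun x => ∫ y, K (x, y) * g y ∂μ, continuous_integral_kernel μ K g⟩
      map_add' := by
        intro g₁ g₂
        ext x
        change ∫ y, K (x, y) * (g₁ + g₂ : Lp ℂ 2 μ) y ∂μ =
          ∫ y, K (x, y) * g₁ y ∂μ + ∫ y, K (x, y) * g₂ y ∂μ
        simp only [integral_kernel_eq_inner, inner_add_right]
      map_smul' := by
        intro c g
        ext x
        change ∫ y, K (x, y) * (c • g : Lp ℂ 2 μ) y ∂μ = c * ∫ y, K (x, y) * g y ∂μ
        simp only [integral_kernel_eq_inner, inner_smul_right] }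
    (‖(ContinuousMap.toLp 2 μ ℂ : C(E, ℂ) →L[ℂ] Lp ℂ 2 μ)‖ * ‖K.curry‖) (by
      intro g
      rw [ContinuousMap.norm_le _ (by positivity)]
      intro x
      change ‖∫ y, K (x, y) * g y ∂μ‖ ≤ _
      rw [integral_kernel_eq_inner]
      refine (norm_inner_le_norm _ _).trans ?_
      gcongr
      refine (ContinuousLinearMap.le_opNorm _ _).trans ?_
      rw [norm_star]
      gcongr
      exact K.curry.norm_coe_le_norm x)

variable [SecondCountableTopology D] [MeasurableSpace D] [BorelSpace D]

/-- The operator `𝒦 : L²(μ) → L²(λ)`, `𝒦[g](x) = ∫ K(x, y) g(y) dμ(y)`, of a continuous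
kernel `K`. -/
def kernelOp (lam : Measure D) [IsFiniteMeasure lam] (μ : Measure E) [IsFiniteMeasure μ]
    (K : C(D × E, ℂ)) : Lp ℂ 2 μ →L[ℂ] Lp ℂ 2 lam :=
  (ContinuousMap.toLp 2 lam ℂ).comp (kernelOpC μ K)

end KernelOperator

/-! ### The Riemann sphere `OnePoint ℂ` and analytic functions on it -/

instance instMeasurableSpaceSphere : MeasurableSpace (OnePoint ℂ) := borel _

instance instBorelSpaceSphere : BorelSpace (OnePoint ℂ) := ⟨rfl⟩

/-- `w ↦ w⁻¹` as a map into the sphere, with `0 ↦ ∞`. -/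
def invChart (w : ℂ) : OnePoint ℂ := if w = 0 then OnePoint.infty else ((w⁻¹ : ℂ) : OnePoint ℂ)

/-- `h` is analytic at every point of `V`; at `∞` this means that `w ↦ h(w⁻¹)` is analytic
at `0`. -/
def AnalyticOnSphere (h : OnePoint ℂ → ℂ) (V : Set (OnePoint ℂ)) : Prop :=
  (∀ z : ℂ, (z : OnePoint ℂ) ∈ V → AnalyticAt ℂ (fun w : ℂ => h w) z) ∧
    (OnePoint.infty ∈ V → AnalyticAt ℂ (fun w : ℂ => h (invChart w)) 0)

/-- `h` represents an element of `H(F)` on the open neighbourhood `U` of `F`: it is analytic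
on `U`, and vanishes at `∞` if `∞ ∈ F`. -/
structure RepresentsOn (F U : Set (OnePoint ℂ)) (h : OnePoint ℂ → ℂ) : Prop where
  isOpen : IsOpen U
  subset : F ⊆ U
  analytic : AnalyticOnSphere h U
  vanish : OnePoint.infty ∈ F → h OnePoint.infty = 0

/-- The open interior of the Bernstein ellipse with parameter `R`, i.e. of the image of the
circle `|ζ| = R` under `ζ ↦ (ζ + ζ⁻¹) / 2`. -/
def bernsteinInterior (R : ℝ) : Set ℂ :=
  {z | ∃ ζ : ℂ, 1 ≤ ‖ζ‖ ∧ ‖ζ‖ < R ∧ z = (ζ + ζ⁻¹) / 2}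

/-- The interval `[-1, 1]` in the sphere. -/
def segmentSphere : Set (OnePoint ℂ) :=
  range fun y : Icc (-1 : ℝ) 1 => (((y : ℝ) : ℂ) : OnePoint ℂ)

/-! ### Contours -/

/-- A rectifiable oriented Jordan curve, parametrized by a Lipschitz function on `[0, 1]`
(for instance proportionally to arc length). -/
structure RectJordanCurve where
  toFun : ℝ → ℂ
  lipschitz : ∃ c, LipschitzOnWith c toFun (Icc 0 1)
  closed : toFun 0 = toFun 1
  injOn : InjOn toFun (Ico 0 1)

/-- A finite formal sum of rectifiable Jordan curves. -/
abbrev Contour := List RectJordanCurve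

/-- The union of the curves of a contour. -/
def Contour.trace (Γ : Contour) : Set ℂ := {ξ | ∃ γ ∈ Γ, ξ ∈ γ.toFun '' Icc 0 1}

/-- `∫_Γ f(ξ) dξ`. -/
def Contour.integral (Γ : Contour) (f : ℂ → ℂ) : ℂ :=
  (Γ.map fun γ => ∫ t in (0 : ℝ)..1, f (γ.toFun t) * deriv γ.toFun t).sum

/-- The winding number of `Γ` about a point of the sphere off `Γ`; it is `0` about `∞`. -/
def Contour.index (Γ : Contour) (z : OnePoint ℂ) : ℂ :=
  z.elim 0 fun w => (2 * Real.pi * Complex.I)⁻¹ * Γ.integral fun ξ => (ξ - w)⁻¹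

/-- `Γ` lies in `U \ F` and `Ind_Γ(F) - Ind_Γ(U') = 1`, where `U'` is the complement of `U` in
the sphere. -/
structure Contour.Separates (Γ : Contour) (F U : Set (OnePoint ℂ)) : Prop where
  trace_subset : ∀ ξ ∈ Γ.trace, (ξ : OnePoint ℂ) ∈ U \ F
  index_eq : ∃ k : ℤ, (∀ z ∈ F, Γ.index z = k + 1) ∧ ∀ w ∈ Uᶜ, Γ.index w = k

/-! ### The spaces `H^p_ν(F)` and the operators `𝒞` and `𝒦'` -/

section Operators

variable {F : Set (OnePoint ℂ)}

/-- The classes in `L^p_ν(F)` of the functions in `H(F)`. -/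
def analyticClasses (p : ℝ≥0∞) (ν : Measure F) : Submodule ℂ (Lp ℂ p ν) where
  carrier := {f | ∃ U h, RepresentsOn F U h ∧ f =ᵐ[ν] fun z : F => h z}
  zero_mem' := ⟨univ, 0, ⟨isOpen_univ, subset_univ _,
    ⟨fun _ _ => analyticAt_const, fun _ => analyticAt_const⟩, fun _ => rfl⟩, Lp.coeFn_zero ..⟩
  add_mem' := by
    rintro f₁ f₂ ⟨U₁, h₁, H₁, e₁⟩ ⟨U₂, h₂, H₂, e₂⟩
    refine ⟨U₁ ∩ U₂, h₁ + h₂, ⟨H₁.isOpen.inter H₂.isOpen, subset_inter H₁.subset H₂.subset,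
      ⟨fun z hz => (H₁.analytic.1 z hz.1).add (H₂.analytic.1 z hz.2),
        fun hz => (H₁.analytic.2 hz.1).add (H₂.analytic.2 hz.2)⟩,
      fun hF => by simp [H₁.vanish hF, H₂.vanish hF]⟩, ?_⟩
    filter_upwards [Lp.coeFn_add f₁ f₂, e₁, e₂] with z hz h1 h2
    rw [hz, Pi.add_apply, h1, h2, Pi.add_apply]
  smul_mem' := by
    rintro c f ⟨U, h, H, e⟩
    refine ⟨U, c • h, ⟨H.isOpen, H.subset,
      ⟨fun z hz => analyticAt_const.mul (H.analytic.1 z hz),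
        fun hz => analyticAt_const.mul (H.analytic.2 hz)⟩,
      fun hF => by simp [H.vanish hF]⟩, ?_⟩
    filter_upwards [Lp.coeFn_smul c f, e] with z hz h1
    rw [hz, Pi.smul_apply, h1, Pi.smul_apply]

/-- The Bergman space `H^p_ν(F)`: the closure in `L^p_ν(F)` of the functions analytic on `F`. -/
def bergman (p : ℝ≥0∞) [Fact (1 ≤ p)] (ν : Measure F) : Submodule ℂ (Lp ℂ p ν) :=
  (analyticClasses p ν).topologicalClosure

/-- The Cauchy transform `𝒞[g](z) = ∫ g(y) / (y - z) dμ(y)`, with value `0` at `z = ∞`. -/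
def cauchyTransform (μ : Measure (Icc (-1 : ℝ) 1)) (g : Icc (-1 : ℝ) 1 → ℂ)
    (z : OnePoint ℂ) : ℂ :=
  z.elim 0 fun w => ∫ y, g y / (((y : ℝ) : ℂ) - w) ∂μ

/-- The bounded operator `T` is the Cauchy transform from `L²_μ(-1, 1)` to `L^p_ν(F)`. -/
def IsCauchyOp (μ : Measure (Icc (-1 : ℝ) 1)) (p : ℝ≥0∞) [Fact (1 ≤ p)] (ν : Measure F)
    (T : Lp ℂ 2 μ →L[ℂ] Lp ℂ p ν) : Prop :=
  ∀ g : Lp ℂ 2 μ, T g =ᵐ[ν] fun z : F => cauchyTransform μ g z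

/-- The norm `‖𝒞‖` from `L²_μ(-1, 1)` to `L^p_ν(F)`; it is `∞` if `𝒞` is not a bounded operator
between these spaces. (There is at most one `T` as below.) -/
def cauchyNorm (μ : Measure (Icc (-1 : ℝ) 1)) (p : ℝ≥0∞) [Fact (1 ≤ p)] (ν : Measure F) :
    ℝ≥0∞ :=
  ⨅ (T : Lp ℂ 2 μ →L[ℂ] Lp ℂ p ν) (_ : IsCauchyOp μ p ν T), ‖T‖ₑ

variable {D : Type*} [MeasurableSpace D]

/-- The bounded operator `T` from `H^p_ν(F)` to `L²_λ(D)` is `𝒦'`: for every `h ∈ H(F)` with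
finite `L^p_ν(F)` norm, `T[h](x) = (2πi)⁻¹ ∫_Γ K(x, ξ) h(ξ) dξ`. Here `Γ ⊆ U \ F` is any contour
with `Ind_Γ(F) - Ind_Γ(U') = 1`, where `h` is analytic on the open set `U ⊇ F`, and `U` is taken
so small that it does not meet `[-1, 1]`, and does not contain `∞` unless `F` does. -/
def IsDualOp (K : D → OnePoint ℂ → ℂ) (lam : Measure D) (p : ℝ≥0∞) [Fact (1 ≤ p)]
    (ν : Measure F) (T : bergman p ν →L[ℂ] Lp ℂ 2 lam) : Prop :=
  ∀ (U : Set (OnePoint ℂ)) (h : OnePoint ℂ → ℂ) (Γ : Contour) (f : bergman p ν),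
    RepresentsOn F U h → Disjoint U segmentSphere → (OnePoint.infty ∈ U → OnePoint.infty ∈ F) →
    Γ.Separates F U →
    (f : Lp ℂ p ν) =ᵐ[ν] (fun z : F => h z) →
    T f =ᵐ[lam] fun x => (2 * Real.pi * Complex.I)⁻¹ * Γ.integral fun ξ => K x ξ * h ξ

/-- The norm `‖𝒦'‖` from `H^p_ν(F)` to `L²_λ(D)`; it is `∞` if `𝒦'` does not define a bounded
operator between these spaces. (There is at most one `T` as below.) -/
def dualNorm (K : D → OnePoint ℂ → ℂ) (lam : Measure D) (p : ℝ≥0∞) [Fact (1 ≤ p)]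
    (ν : Measure F) : ℝ≥0∞ :=
  ⨅ (T : bergman p ν →L[ℂ] Lp ℂ 2 lam) (_ : IsDualOp K lam p ν T), ‖T‖ₑ

end Operators

end LowRank

end

/-!
Let `q` be a polynomial with simple zeros, all of them in `[-1, 1]`, and let `K_q(x, ·)`
interpolate `K(x, ·)` at the zeros of `q`. On the segment, the Cauchy kernel `(y - ξ)⁻¹` differs
from its interpolant in `y` by `q(y) / (q(ξ) (y - ξ))`. Cauchy's formula for `K(x, ·)` on a
clockwise ellipse inside `B_R`, which is an admissible contour for `𝒦'` (up to a large circle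
that does not contribute), therefore gives `𝒦 - 𝒦_q = 𝒦' ∘ (1 / q) ∘ 𝒞 ∘ q`, where `q` and
`1 / q` act by multiplication. For the Chebyshev polynomial `q = T_n`, `|q| ≤ 1` on `[-1, 1]` and
`|q| ≥ (R^n - R^(-n)) / 2` off `B_R`.
-/

noncomputable section

namespace LowRank

open Complex Metric Filter Topology Polynomial Bornology

/-! ### Interpolation of the Cauchy kernel -/

section CauchyKernelInterpolation

variable {𝕜 ι : Type*} [Field 𝕜] {s : Finset ι} {v : ι → 𝕜} {q : 𝕜[X]}

theorem inv_sub_sub_eval_interpolate [DecidableEq ι] (hv : InjOn v s) (hdeg : q.degree ≤ s.card)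
    (hq : ∀ i ∈ s, q.eval (v i) = 0) {ξ y : 𝕜} (hξ : q.eval ξ ≠ 0) (hy : y ≠ ξ) :
    (y - ξ)⁻¹ - (Lagrange.interpolate s v fun i => (v i - ξ)⁻¹).eval y =
      q.eval y / (q.eval ξ * (y - ξ)) := by
  have hq0 : q ≠ 0 := by
    rintro rfl
    simp at hξ
  set P := q /ₘ (X - C ξ)
  have hP (z : 𝕜) : (z - ξ) * P.eval z = q.eval z - q.eval ξ := by
    simpa [modByMonic_X_sub_C_eq_C_eval] using
      congrArg (eval z) (X_sub_C_mul_divByMonic_eq_sub_modByMonic q ξ)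
  have hinterp : C (-(q.eval ξ)⁻¹) * P = Lagrange.interpolate s v fun i => (v i - ξ)⁻¹ := by
    refine Lagrange.eq_interpolate_of_eval_eq _ hv ?_ fun i hi => ?_
    · have hlt : P.degree < q.degree := degree_divByMonic_lt q _ hq0 (by simp)
      exact (degree_C_mul (by simpa using hξ)).trans_lt (hlt.trans_le hdeg)
    · have hne : v i - ξ ≠ 0 := sub_ne_zero.2 fun h => hξ (h ▸ hq i hi)
      have hPi := hP (v i)
      rw [hq i hi] at hPi
      simp only [eval_mul, eval_C]
      field_simp
      linear_combination -hPi
  have hyξ : y - ξ ≠ 0 := sub_ne_zero.2 hy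
  rw [← hinterp]
  simp only [eval_mul, eval_C]
  field_simp
  linear_combination hP y

theorem eval_interpolate_eq_sum [DecidableEq ι] (u : ι → 𝕜) (y : 𝕜) :
    (Lagrange.interpolate s v u).eval y = ∑ i ∈ s, u i * (Lagrange.basis s v i).eval y := by
  simp only [Lagrange.interpolate_apply, eval_finsetSum, eval_mul, eval_C]

theorem eval_ne_zero_of_forall_ne (hv : InjOn v s) (hdeg : q.degree = s.card)
    (hq : ∀ i ∈ s, q.eval (v i) = 0) {z : 𝕜} (hz : ∀ i ∈ s, v i ≠ z) : q.eval z ≠ 0 := by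
  classical
  intro hqz
  have hzs : z ∉ s.image v := by simpa using hz
  have hcard : (insert z (s.image v)).card = s.card + 1 := by
    rw [Finset.card_insert_of_notMem hzs, Finset.card_image_of_injOn hv]
  have hq0 : q = 0 := by
    refine eq_zero_of_degree_lt_of_eval_finset_eq_zero (insert z (s.image v)) ?_ ?_
    · rw [hdeg, hcard]
      exact_mod_cast s.card.lt_succ_self
    · simpa [hqz] using hq
  simp [hq0] at hdeg

end CauchyKernelInterpolation

/-! ### The Joukowski map and Chebyshev polynomials -/

/-- The Joukowski map `ζ ↦ (ζ + ζ⁻¹) / 2`, which sends the circles `|ζ| = r` and `|ζ| = r⁻¹` to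
the Bernstein ellipse with parameter `r`. -/
def joukowski (ζ : ℂ) : ℂ := (ζ + ζ⁻¹) / 2

theorem joukowski_inv (ζ : ℂ) : joukowski ζ⁻¹ = joukowski ζ := by
  simp [joukowski, add_comm]

theorem joukowski_exp (w : ℂ) : joukowski (exp w) = Complex.cosh w := by
  rw [joukowski, ← Complex.exp_neg, Complex.cosh]

theorem joukowski_sub_joukowski {ζ η : ℂ} (hζ : ζ ≠ 0) (hη : η ≠ 0) :
    joukowski ζ - joukowski η = (ζ - η) * (ζ * η - 1) / (2 * ζ * η) := by
  unfold joukowski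
  field_simp
  ring

theorem joukowski_eq_iff {ζ η : ℂ} (hζ : ζ ≠ 0) (hη : η ≠ 0) :
    joukowski ζ = joukowski η ↔ ζ = η ∨ ζ = η⁻¹ := by
  rw [← sub_eq_zero, joukowski_sub_joukowski hζ hη, ← mul_eq_one_iff_eq_inv₀ hη]
  simp [hζ, hη, sub_eq_zero]

theorem exists_joukowski_eq (z : ℂ) : ∃ ζ : ℂ, 1 ≤ ‖ζ‖ ∧ joukowski ζ = z := by
  obtain ⟨w, rfl⟩ := Complex.cos_surjective z
  have hw : joukowski (exp (w * I)) = Complex.cos w := by rw [joukowski_exp, Complex.cosh_mul_I]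
  rcases le_total 1 ‖exp (w * I)‖ with h | h
  · exact ⟨_, h, hw⟩
  · refine ⟨(exp (w * I))⁻¹, ?_, by rw [joukowski_inv, hw]⟩
    rw [norm_inv]
    exact (one_le_inv₀ (norm_pos_iff.2 (exp_ne_zero _))).2 h

theorem exists_norm_eq_one_joukowski_eq {y : ℝ} (hy : y ∈ Icc (-1 : ℝ) 1) :
    ∃ η : ℂ, ‖η‖ = 1 ∧ joukowski η = y := by
  refine ⟨exp (Real.arccos y * I), norm_exp_ofReal_mul_I _, ?_⟩
  rw [joukowski_exp, Complex.cosh_mul_I, ← ofReal_cos, Real.cos_arccos hy.1 hy.2]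

theorem joukowski_mem_bernsteinInterior {R : ℝ} (hR : 0 < R) {ζ : ℂ} (h₁ : R⁻¹ < ‖ζ‖)
    (h₂ : ‖ζ‖ < R) : joukowski ζ ∈ bernsteinInterior R := by
  rcases le_total 1 ‖ζ‖ with h | h
  · exact ⟨ζ, h, h₂, rfl⟩
  · refine ⟨ζ⁻¹, ?_, ?_, (joukowski_inv ζ).symm⟩ <;> rw [norm_inv]
    · exact (one_le_inv₀ ((inv_pos.2 hR).trans h₁)).2 h
    · exact inv_lt_of_inv_lt₀ hR h₁

theorem ofReal_mem_bernsteinInterior {R : ℝ} (hR : 1 < R) {y : ℝ} (hy : y ∈ Icc (-1 : ℝ) 1) :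
    (y : ℂ) ∈ bernsteinInterior R := by
  obtain ⟨η, hη, hJ⟩ := exists_norm_eq_one_joukowski_eq hy
  exact ⟨η, hη.ge, hη.trans_lt hR, hJ.symm⟩

theorem sub_inv_div_two_le_norm_joukowski (ζ : ℂ) : (‖ζ‖ - ‖ζ‖⁻¹) / 2 ≤ ‖joukowski ζ‖ := by
  have h : ‖ζ‖ - ‖ζ‖⁻¹ ≤ ‖ζ + ζ⁻¹‖ := by
    simpa using norm_sub_norm_le ζ (-ζ⁻¹)
  rw [joukowski, norm_div, Complex.norm_ofNat]
  gcongr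

theorem eval_chebyshevT_joukowski (n : ℕ) {ζ : ℂ} (hζ : ζ ≠ 0) :
    (Chebyshev.T ℂ n).eval (joukowski ζ) = joukowski (ζ ^ n) := by
  obtain ⟨w, rfl⟩ : ∃ w, exp w = ζ := ⟨log ζ, exp_log hζ⟩
  rw [← Complex.exp_nat_mul, joukowski_exp, joukowski_exp]
  exact_mod_cast Chebyshev.T_complex_cosh w n

theorem le_norm_eval_chebyshevT (n : ℕ) {R : ℝ} (hR : 1 < R) {z : ℂ}
    (hz : z ∉ bernsteinInterior R) :
    (R ^ n - (R ^ n)⁻¹) / 2 ≤ ‖(Chebyshev.T ℂ n).eval z‖ := by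
  obtain ⟨ζ, hζ, rfl⟩ := exists_joukowski_eq z
  have hRζ : R ≤ ‖ζ‖ := le_of_not_gt fun h => hz ⟨ζ, hζ, h, rfl⟩
  have hpow : R ^ n ≤ ‖ζ ^ n‖ := by
    rw [norm_pow]
    gcongr
  rw [eval_chebyshevT_joukowski n (norm_pos_iff.1 (by linarith))]
  refine le_trans ?_ (sub_inv_div_two_le_norm_joukowski _)
  gcongr

theorem norm_eval_chebyshevT_le_one (n : ℕ) (y : Icc (-1 : ℝ) 1) :
    ‖(Chebyshev.T ℂ n).eval ((y : ℝ) : ℂ)‖ ≤ 1 := by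
  rw [← Chebyshev.complex_ofReal_eval_T, Complex.norm_real]
  exact Chebyshev.abs_eval_T_real_le_one n (abs_le.2 y.2)

/-- The zeros of the Chebyshev polynomial of degree `n`, the interpolation nodes. -/
def chebyshevNode (n : ℕ) (j : Fin n) : Icc (-1 : ℝ) 1 :=
  ⟨Real.cos ((2 * j + 1) * Real.pi / (2 * n)), Real.neg_one_le_cos _, Real.cos_le_one _⟩

theorem chebyshevNode_injective (n : ℕ) : Function.Injective (chebyshevNode n) := by
  have angle_mem (j : Fin n) : (2 * (j : ℝ) + 1) * Real.pi / (2 * n) ∈ Icc 0 Real.pi := by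
    have hn : (0 : ℝ) < n := Nat.cast_pos.2 (Fin.pos j)
    have hj : (j : ℝ) + 1 ≤ n := by exact_mod_cast j.2
    refine ⟨by positivity, ?_⟩
    rw [div_le_iff₀ (by positivity)]
    nlinarith [Real.pi_pos]
  intro i j hij
  have hn : (0 : ℝ) < n := Nat.cast_pos.2 (Fin.pos j)
  have hangle := Real.injOn_cos (angle_mem i) (angle_mem j) (congrArg Subtype.val hij)
  field_simp at hangle
  exact Fin.ext (by exact_mod_cast (by linarith : (i : ℝ) = j))

theorem eval_chebyshevT_node (n : ℕ) (j : Fin n) :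
    (Chebyshev.T ℂ n).eval ((chebyshevNode n j : ℝ) : ℂ) = 0 := by
  have hn : (n : ℝ) ≠ 0 := Nat.cast_ne_zero.2 (Fin.pos j).ne'
  have hreal : (Chebyshev.T ℝ n).eval (chebyshevNode n j : ℝ) = 0 := by
    rw [chebyshevNode, Chebyshev.T_real_cos, Real.cos_eq_zero_iff]
    exact ⟨j, by push_cast; field_simp⟩
  rw [← Chebyshev.complex_ofReal_eval_T, hreal, ofReal_zero]

/-! ### Integration along curves -/

/-- The integral `∫_γ f(ξ) dξ` along a single rectifiable Jordan curve. -/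
def RectJordanCurve.integral (γ : RectJordanCurve) (f : ℂ → ℂ) : ℂ :=
  ∫ t in (0 : ℝ)..1, f (γ.toFun t) * deriv γ.toFun t

/-- The set of points of a Jordan curve. -/
def RectJordanCurve.trace (γ : RectJordanCurve) : Set ℂ := γ.toFun '' Icc 0 1

@[simp]
theorem Contour.integral_nil (f : ℂ → ℂ) : Contour.integral [] f = 0 := rfl

@[simp]
theorem Contour.integral_cons (γ : RectJordanCurve) (Γ : Contour) (f : ℂ → ℂ) :
    Contour.integral (γ :: Γ) f = γ.integral f + Γ.integral f := by
  simp [Contour.integral, RectJordanCurve.integral]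

namespace RectJordanCurve

variable (γ : RectJordanCurve)

theorem continuousOn_toFun : ContinuousOn γ.toFun (Icc 0 1) :=
  γ.lipschitz.choose_spec.continuousOn

theorem intervalIntegrable_deriv : IntervalIntegrable (deriv γ.toFun) volume 0 1 := by
  obtain ⟨c, hc⟩ := γ.lipschitz
  rw [intervalIntegrable_iff_integrableOn_Ioo_of_le zero_le_one]
  refine Measure.integrableOn_of_bounded (M := c) (by simp)
    (aestronglyMeasurable_deriv _ _) (ae_restrict_of_forall_mem measurableSet_Ioo fun t ht => ?_)
  exact norm_deriv_le_of_lipschitzOn (Icc_mem_nhds ht.1 ht.2) hc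

variable {γ}

theorem integral_congr {f₁ f₂ : ℂ → ℂ} (h : EqOn f₁ f₂ γ.trace) :
    γ.integral f₁ = γ.integral f₂ :=
  intervalIntegral.integral_congr fun t ht => by
    simp only [h (mem_image_of_mem _ (uIcc_of_le (zero_le_one (α := ℝ)) ▸ ht))]

theorem intervalIntegrable_mul_deriv {f : ℂ → ℂ} (hf : ContinuousOn f γ.trace) :
    IntervalIntegrable (fun t => f (γ.toFun t) * deriv γ.toFun t) volume 0 1 := by
  refine γ.intervalIntegrable_deriv.continuousOn_mul ?_
  rw [uIcc_of_le zero_le_one]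
  exact hf.comp γ.continuousOn_toFun (mapsTo_image _ _)

theorem integral_const_mul (c : ℂ) (f : ℂ → ℂ) :
    γ.integral (fun ξ => c * f ξ) = c * γ.integral f := by
  simp only [integral, mul_assoc, intervalIntegral.integral_const_mul]

theorem integral_sub {f₁ f₂ : ℂ → ℂ} (h₁ : ContinuousOn f₁ γ.trace)
    (h₂ : ContinuousOn f₂ γ.trace) :
    γ.integral (fun ξ => f₁ ξ - f₂ ξ) = γ.integral f₁ - γ.integral f₂ := by
  simp only [integral, sub_mul]
  exact intervalIntegral.integral_sub (intervalIntegrable_mul_deriv h₁)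
    (intervalIntegrable_mul_deriv h₂)

theorem integral_finsetSum {ι : Type*} (s : Finset ι) {f : ι → ℂ → ℂ}
    (h : ∀ i ∈ s, ContinuousOn (f i) γ.trace) :
    γ.integral (fun ξ => ∑ i ∈ s, f i ξ) = ∑ i ∈ s, γ.integral (f i) := by
  simp only [integral, Finset.sum_mul]
  exact intervalIntegral.integral_finsetSum fun i hi => intervalIntegrable_mul_deriv (h i hi)

theorem integral_integral_swap {E : Type*} [TopologicalSpace E] [CompactSpace E]
    [SecondCountableTopology E] [MeasurableSpace E] [OpensMeasurableSpace E] {μ : Measure E}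
    [SFinite μ] {A : ℂ → E → ℂ}
    (hA : ContinuousOn (Function.uncurry A) (γ.trace ×ˢ univ))
    {g : E → ℂ} (hg : Integrable g μ) :
    γ.integral (fun ξ => ∫ y, A ξ y * g y ∂μ) = ∫ y, γ.integral (A · y) * g y ∂μ := by
  have hAγ : ContinuousOn (fun z : ℝ × E => A (γ.toFun z.1) z.2) (Icc 0 1 ×ˢ univ) :=
    hA.comp ((γ.continuousOn_toFun.comp continuousOn_fst fun z hz => hz.1).prodMk
      continuousOn_snd) fun z hz => ⟨mem_image_of_mem _ hz.1, hz.2⟩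
  have hprod : (volume.restrict (Ioc (0 : ℝ) 1)).prod μ =
      (volume.prod μ).restrict (Ioc (0 : ℝ) 1 ×ˢ univ) := by
    rw [← Measure.prod_restrict, Measure.restrict_univ]
  have hmeas : MeasurableSet (Ioc (0 : ℝ) 1 ×ˢ (univ : Set E)) :=
    measurableSet_Ioc.prod MeasurableSet.univ
  have hsub : Ioc (0 : ℝ) 1 ×ˢ (univ : Set E) ⊆ Icc 0 1 ×ˢ univ :=
    prod_mono Ioc_subset_Icc_self subset_rfl
  have hint : Integrable (fun z : ℝ × E => A (γ.toFun z.1) z.2 * (deriv γ.toFun z.1 * g z.2))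
      ((volume.restrict (Ioc 0 1)).prod μ) := by
    obtain ⟨c, hc⟩ := (isCompact_Icc.prod isCompact_univ).exists_bound_of_continuousOn hAγ
    have hγ := (intervalIntegrable_iff_integrableOn_Ioc_of_le zero_le_one).1
      γ.intervalIntegrable_deriv
    refine (hγ.mul_prod hg).bdd_mul (c := c) ?_ ?_ <;> rw [hprod]
    · exact (hAγ.mono hsub).aestronglyMeasurable hmeas
    · exact ae_restrict_of_forall_mem hmeas fun z hz => hc z (hsub hz)
  calc γ.integral (fun ξ => ∫ y, A ξ y * g y ∂μ)
      = ∫ t in (0 : ℝ)..1, ∫ y, A (γ.toFun t) y * (deriv γ.toFun t * g y) ∂μ := by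
        simp only [integral, ← MeasureTheory.integral_mul_const, mul_assoc,
          mul_comm (deriv γ.toFun _)]
    _ = ∫ y, (∫ t in (0 : ℝ)..1, A (γ.toFun t) y * (deriv γ.toFun t * g y)) ∂μ := by
        refine intervalIntegral_integral_swap ?_
        rwa [uIoc_of_le zero_le_one]
    _ = ∫ y, γ.integral (A · y) * g y ∂μ := by
        simp only [integral, ← intervalIntegral.integral_mul_const, mul_assoc]

theorem circleMap_two_pi_mul_injOn {ρ : ℝ} (hρ : 0 < ρ) :
    InjOn (fun t : ℝ => circleMap 0 ρ (2 * Real.pi * t)) (Ico 0 1) := by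
  intro t ht u hu h
  have hpi := Real.pi_pos
  have := injOn_circleMap_of_abs_sub_le' (c := 0) (R := ρ) hρ.ne' (a := 0) (b := 2 * Real.pi)
    (by simp) (x₁ := 2 * Real.pi * t) ⟨by nlinarith [ht.1], by nlinarith [ht.2]⟩
    (x₂ := 2 * Real.pi * u) ⟨by nlinarith [hu.1], by nlinarith [hu.2]⟩ h
  exact mul_left_cancel₀ (by positivity) this

variable {φ : ℂ → ℂ} {ρ : ℝ}

/-- The image of the counterclockwise circle `|ζ| = ρ` under an analytic map `φ` that is
injective on it. -/
def circleImage (φ : ℂ → ℂ) (ρ : ℝ) (hρ : 0 < ρ) (hφ : AnalyticOnNhd ℂ φ (sphere 0 ρ))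
    (hinj : InjOn φ (sphere 0 ρ)) : RectJordanCurve where
  toFun t := φ (circleMap 0 ρ (2 * Real.pi * t))
  lipschitz := by
    have hcircle : ContDiff ℝ 1 fun t : ℝ => circleMap 0 ρ (2 * Real.pi * t) :=
      (contDiff_circleMap 0 ρ).comp (contDiff_const.mul contDiff_id)
    have hcontDiff : ContDiff ℝ 1 fun t : ℝ => φ (circleMap 0 ρ (2 * Real.pi * t)) :=
      contDiff_iff_contDiffAt.2 fun t =>
        ((hφ _ (circleMap_mem_sphere 0 hρ.le (2 * Real.pi * t))).contDiffAt.restrict_scalars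
          ℝ).comp t hcircle.contDiffAt
    exact hcontDiff.contDiffOn.exists_lipschitzOnWith one_ne_zero (convex_Icc 0 1) isCompact_Icc
  closed := by simp [circleMap]
  injOn := hinj.comp (circleMap_two_pi_mul_injOn hρ) fun _ _ => circleMap_mem_sphere 0 hρ.le _

theorem trace_circleImage_subset (hρ : 0 < ρ) (hφ : AnalyticOnNhd ℂ φ (sphere 0 ρ))
    (hinj : InjOn φ (sphere 0 ρ)) :
    (circleImage φ ρ hρ hφ hinj).trace ⊆ φ '' sphere 0 ρ := by
  rintro - ⟨t, -, rfl⟩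
  exact mem_image_of_mem _ (circleMap_mem_sphere 0 hρ.le _)

theorem integral_circleImage (hρ : 0 < ρ) (hφ : AnalyticOnNhd ℂ φ (sphere 0 ρ))
    (hinj : InjOn φ (sphere 0 ρ)) (f : ℂ → ℂ) :
    (circleImage φ ρ hρ hφ hinj).integral f = ∮ ζ in C(0, ρ), f (φ ζ) * deriv φ ζ := by
  have hderiv (t : ℝ) : deriv (circleImage φ ρ hρ hφ hinj).toFun t =
      2 * Real.pi * (deriv (circleMap 0 ρ) (2 * Real.pi * t) *
        deriv φ (circleMap 0 ρ (2 * Real.pi * t))) := by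
    have hcircle : HasDerivAt (fun t : ℝ => circleMap 0 ρ (2 * Real.pi * t))
        ((2 * Real.pi : ℝ) • deriv (circleMap 0 ρ) (2 * Real.pi * t)) t :=
      (differentiable_circleMap 0 ρ _).hasDerivAt.scomp t
        (by simpa using (hasDerivAt_id t).const_mul (2 * Real.pi))
    have hφt := (hφ _ (circleMap_mem_sphere 0 hρ.le (2 * Real.pi * t))).differentiableAt.hasDerivAt
    refine (hφt.comp t hcircle).deriv.trans ?_
    rw [real_smul]
    push_cast
    ring
  have hscale := intervalIntegral.smul_integral_comp_mul_left (a := 0) (b := 1)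
    (fun θ : ℝ => deriv (circleMap 0 ρ) θ •
      (f (φ (circleMap 0 ρ θ)) * deriv φ (circleMap 0 ρ θ))) (2 * Real.pi)
  rw [mul_zero, mul_one] at hscale
  rw [circleIntegral, ← hscale, ← intervalIntegral.integral_smul, integral]
  refine intervalIntegral.integral_congr fun t _ => ?_
  simp only [hderiv, real_smul, smul_eq_mul]
  push_cast
  simp only [circleImage]
  ring

/-- The counterclockwise circle about `0` of radius `ρ`. -/
def circle (ρ : ℝ) (hρ : 0 < ρ) : RectJordanCurve :=
  circleImage id ρ hρ analyticOnNhd_id (injOn_id _)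

theorem trace_circle_subset (hρ : 0 < ρ) : (circle ρ hρ).trace ⊆ sphere 0 ρ :=
  (trace_circleImage_subset hρ _ _).trans (image_id _).subset

theorem integral_circle (hρ : 0 < ρ) (f : ℂ → ℂ) :
    (circle ρ hρ).integral f = ∮ ζ in C(0, ρ), f ζ := by
  rw [circle, integral_circleImage]
  simp only [deriv_id, id, mul_one]

end RectJordanCurve

/-! ### Cauchy's theorem on ellipses -/

theorem analyticAt_joukowski {ζ : ℂ} (hζ : ζ ≠ 0) : AnalyticAt ℂ joukowski ζ := by
  unfold joukowski
  fun_prop (disch := assumption)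

theorem analyticOnNhd_joukowski {s : ℝ} (hs : s ≠ 0) : AnalyticOnNhd ℂ joukowski (sphere 0 s) :=
  fun _ hζ => analyticAt_joukowski (ne_of_mem_sphere hζ hs)

theorem deriv_joukowski {ζ : ℂ} (hζ : ζ ≠ 0) : deriv joukowski ζ = (1 - (ζ ^ 2)⁻¹) / 2 :=
  (((hasDerivAt_id ζ).add (hasDerivAt_inv hζ)).div_const 2).deriv

theorem injOn_joukowski_sphere {s : ℝ} (hs : 0 < s) (hs1 : s ≠ 1) :
    InjOn joukowski (sphere 0 s) := by
  intro ζ hζ η hη h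
  refine ((joukowski_eq_iff (ne_of_mem_sphere hζ hs.ne') (ne_of_mem_sphere hη hs.ne')).1
    h).resolve_right fun hinv => hs1 ?_
  have hnorm := congrArg norm hinv
  rw [norm_inv, mem_sphere_zero_iff_norm.1 hζ, mem_sphere_zero_iff_norm.1 hη] at hnorm
  rwa [← mul_eq_one_iff_eq_inv₀ hs.ne', mul_self_eq_one_iff, or_iff_left (by linarith)] at hnorm

theorem deriv_joukowski_mul_inv_sub {ζ η : ℂ} (hζ : ζ ≠ 0) (hη : η ≠ 0) (h₁ : ζ ≠ η)
    (h₂ : ζ ≠ η⁻¹) :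
    (joukowski ζ - joukowski η)⁻¹ * deriv joukowski ζ = (ζ - η)⁻¹ + (ζ - η⁻¹)⁻¹ - (ζ - 0)⁻¹ := by
  have hη₁ : ζ - η ≠ 0 := sub_ne_zero.2 h₁
  have hη₂ : ζ * η - 1 ≠ 0 := fun h => h₂ ((mul_eq_one_iff_eq_inv₀ hη).1 (sub_eq_zero.1 h))
  have hinv : ζ - η⁻¹ = (ζ * η - 1) / η := by field_simp
  rw [deriv_joukowski hζ, joukowski_sub_joukowski hζ hη, hinv, sub_zero]
  field_simp
  ring

theorem circleIntegral_inv_sub_of_notMem_closedBall {c w : ℂ} {s : ℝ} (hs : 0 < s)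
    (hw : w ∉ closedBall c s) : ∮ ζ in C(c, s), (ζ - w)⁻¹ = 0 := by
  refine (DifferentiableOn.diffContOnCl fun ζ hζ => ?_).circleIntegral_eq_zero hs.le
  rw [closure_ball _ hs.ne'] at hζ
  have hne : ζ - w ≠ 0 := sub_ne_zero.2 fun h => hw (h ▸ hζ)
  fun_prop (disch := assumption)

/-- The boundary of the Bernstein ellipse with parameter `r`, traversed clockwise: it is
parametrized by the circle of radius `r⁻¹ < 1`, on which the Joukowski map reverses orientation. -/
def bernsteinEllipse (r : ℝ) (hr : 1 < r) : RectJordanCurve :=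
  .circleImage joukowski r⁻¹ (by positivity) (analyticOnNhd_joukowski (by positivity))
    (injOn_joukowski_sphere (by positivity) (inv_lt_one_of_one_lt₀ hr).ne)

section BernsteinEllipse

variable {r R : ℝ} (hr : 1 < r)

theorem integral_bernsteinEllipse (f : ℂ → ℂ) :
    (bernsteinEllipse r hr).integral f =
      ∮ ζ in C(0, r⁻¹), f (joukowski ζ) * deriv joukowski ζ :=
  RectJordanCurve.integral_circleImage ..

theorem trace_bernsteinEllipse_subset_image :
    (bernsteinEllipse r hr).trace ⊆ joukowski '' sphere 0 r⁻¹ :=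
  RectJordanCurve.trace_circleImage_subset ..

theorem trace_bernsteinEllipse_subset (hrR : r < R) :
    (bernsteinEllipse r hr).trace ⊆ bernsteinInterior R := by
  refine (trace_bernsteinEllipse_subset_image hr).trans ?_
  rintro - ⟨ζ, hζ, rfl⟩
  rw [mem_sphere_zero_iff_norm] at hζ
  refine joukowski_mem_bernsteinInterior (by linarith) ?_ ?_ <;> rw [hζ]
  · gcongr
  · linarith [inv_lt_one_of_one_lt₀ hr]

theorem disjoint_trace_bernsteinEllipse :
    Disjoint (bernsteinEllipse r hr).trace (bernsteinInterior r) := by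
  refine Disjoint.mono_left (trace_bernsteinEllipse_subset_image hr) ?_
  rw [Set.disjoint_left]
  rintro - ⟨ζ, hζ, rfl⟩ ⟨η, hη1, hηr, h⟩
  have hs1 : r⁻¹ < 1 := inv_lt_one_of_one_lt₀ hr
  rw [mem_sphere_zero_iff_norm] at hζ
  have hζ0 : ζ ≠ 0 := norm_pos_iff.1 (hζ ▸ by positivity)
  have hη0 : η ≠ 0 := norm_pos_iff.1 (by linarith)
  rcases (joukowski_eq_iff hζ0 hη0).1 h with rfl | rfl
  · linarith
  · rw [norm_inv, inv_inj] at hζ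
    linarith

/-- The substitution `ζ ↦ ζ⁻¹` fixes `joukowski ζ` but reverses the unit circle. -/
theorem circleIntegral_comp_joukowski_mul_deriv (G : ℂ → ℂ) :
    ∮ ζ in C(0, 1), G (joukowski ζ) * deriv joukowski ζ = 0 := by
  have hcos (θ : ℝ) : joukowski (circleMap 0 1 θ) = Complex.cos θ := by
    rw [← Complex.cosh_mul_I, ← joukowski_exp]
    simp [circleMap]
  have hintegrand (θ : ℝ) : deriv (circleMap 0 1) θ •
      (G (joukowski (circleMap 0 1 θ)) * deriv joukowski (circleMap 0 1 θ)) =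
      -(G (Complex.cos θ) * Complex.sin θ) := by
    have hexp := Complex.exp_ne_zero (θ * I)
    rw [hcos, deriv_joukowski (circleMap_ne_center one_ne_zero), deriv_circleMap, circleMap,
      Complex.sin, neg_mul, Complex.exp_neg, smul_eq_mul]
    simp only [ofReal_one, one_mul, zero_add]
    field_simp
    ring_nf
  have hreflect := intervalIntegral.integral_comp_sub_left (a := 0) (b := 2 * Real.pi)
    (fun θ : ℝ => -(G (Complex.cos θ) * Complex.sin θ)) (2 * Real.pi)
  simp only [sub_self, sub_zero, ofReal_sub, ofReal_mul, ofReal_ofNat, Complex.cos_two_pi_sub,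
    Complex.sin_two_pi_sub, mul_neg, neg_neg] at hreflect
  simp only [circleIntegral, hintegrand]
  rw [intervalIntegral.integral_neg] at hreflect ⊢
  linear_combination (-1 / 2 : ℂ) * hreflect

/-- The integral can be moved to the unit circle, where it vanishes by symmetry. -/
theorem integral_bernsteinEllipse_eq_zero (hrR : r < R) {G : ℂ → ℂ}
    (hG : ∀ z ∈ bernsteinInterior R, DifferentiableAt ℂ G z) :
    (bernsteinEllipse r hr).integral G = 0 := by
  have hs1 : r⁻¹ < 1 := inv_lt_one_of_one_lt₀ hr
  have hR0 : 0 < R := by linarith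
  have hdiff (ζ : ℂ) (h₁ : r⁻¹ ≤ ‖ζ‖) (h₂ : ‖ζ‖ ≤ 1) :
      DifferentiableAt ℂ (fun ζ => G (joukowski ζ) * deriv joukowski ζ) ζ := by
    have hJ := analyticAt_joukowski (norm_pos_iff.1 (lt_of_lt_of_le (by positivity) h₁))
    have hmem : joukowski ζ ∈ bernsteinInterior R :=
      joukowski_mem_bernsteinInterior hR0 (lt_of_lt_of_le (by gcongr) h₁) (by linarith)
    exact ((hG _ hmem).comp ζ hJ.differentiableAt).mul hJ.deriv.differentiableAt
  rw [integral_bernsteinEllipse]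
  refine (circleIntegral_eq_of_differentiable_on_annulus_off_countable (c := 0)
    (f := fun ζ => G (joukowski ζ) * deriv joukowski ζ) (by positivity) hs1.le
    countable_empty ?_ ?_).symm.trans (circleIntegral_comp_joukowski_mul_deriv G)
  · intro ζ hζ
    simp only [Set.mem_sdiff, mem_closedBall, mem_ball, dist_zero_right, not_lt] at hζ
    exact (hdiff ζ hζ.2 hζ.1).continuousAt.continuousWithinAt
  · intro ζ hζ
    simp only [Set.mem_sdiff, mem_closedBall, mem_ball, dist_zero_right, not_le] at hζ
    exact hdiff ζ hζ.1.2.le hζ.1.1.le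

theorem integral_bernsteinEllipse_inv_sub_of_notMem (hrR : r < R) {w : ℂ}
    (hw : w ∉ bernsteinInterior R) : (bernsteinEllipse r hr).integral (fun ξ => (ξ - w)⁻¹) = 0 := by
  refine integral_bernsteinEllipse_eq_zero hr hrR fun z hz => ?_
  have hne : z - w ≠ 0 := sub_ne_zero.2 fun h => hw (h ▸ hz)
  fun_prop (disch := assumption)

/-- Of the poles `η`, `η⁻¹`, `0` in `ζ` of the transformed integrand, only `0` lies inside the
circle of radius `r⁻¹`. -/
theorem integral_bernsteinEllipse_inv_sub {w : ℂ} (hw : w ∈ bernsteinInterior r) :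
    (bernsteinEllipse r hr).integral (fun ξ => (ξ - w)⁻¹) = -(2 * Real.pi * I) := by
  obtain ⟨η, hη1, hηr, hηw⟩ := hw
  obtain rfl : w = joukowski η := hηw
  have hs : 0 < r⁻¹ := by positivity
  have hη0 : η ≠ 0 := norm_pos_iff.1 (by linarith)
  have hη : η ∉ closedBall 0 r⁻¹ := by
    simpa using (inv_lt_one_of_one_lt₀ hr).trans_le hη1
  have hη' : η⁻¹ ∉ closedBall 0 r⁻¹ := by
    simpa using inv_strictAnti₀ (norm_pos_iff.2 hη0) hηr
  have hne {p ζ : ℂ} (hp : p ∉ closedBall 0 r⁻¹) (hζ : ζ ∈ sphere 0 r⁻¹) : ζ ≠ p :=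
    fun h => hp (h ▸ sphere_subset_closedBall hζ)
  have hint {p : ℂ} (hp : p ∉ sphere 0 r⁻¹) : CircleIntegrable (fun ζ => (ζ - p)⁻¹) 0 r⁻¹ :=
    circleIntegrable_sub_inv_iff.2 (Or.inr (by rwa [abs_of_pos hs]))
  have hintη := hint fun h => hη (sphere_subset_closedBall h)
  have hintη' := hint fun h => hη' (sphere_subset_closedBall h)
  have hintη_add : CircleIntegrable (fun ζ => (ζ - η)⁻¹ + (ζ - η⁻¹)⁻¹) 0 r⁻¹ :=
    hintη.add hintη'
  rw [integral_bernsteinEllipse, circleIntegral.integral_congr hs.le fun ζ hζ =>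
      deriv_joukowski_mul_inv_sub (ne_of_mem_sphere hζ hs.ne') hη0 (hne hη hζ) (hne hη' hζ),
    circleIntegral.integral_sub hintη_add (hint (by simpa using hs.ne)),
    circleIntegral.integral_add hintη hintη', circleIntegral.integral_sub_center_inv 0 hs.ne',
    circleIntegral_inv_sub_of_notMem_closedBall hs hη,
    circleIntegral_inv_sub_of_notMem_closedBall hs hη']
  ring

theorem differentiableAt_dslope {f : ℂ → ℂ} {w z : ℂ} (hw : AnalyticAt ℂ f w)
    (hz : AnalyticAt ℂ f z) : DifferentiableAt ℂ (dslope f w) z := by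
  have hopen : IsOpen {ξ | AnalyticAt ℂ f ξ} := isOpen_analyticAt ℂ f
  have hdiff : DifferentiableOn ℂ f {ξ | AnalyticAt ℂ f ξ} := fun ξ hξ =>
    AnalyticAt.differentiableWithinAt hξ
  exact ((Complex.differentiableOn_dslope (hopen.mem_nhds hw)).2 hdiff).differentiableAt
    (hopen.mem_nhds hz)

theorem integral_bernsteinEllipse_mul_inv_sub (hrR : r < R) {f : ℂ → ℂ}
    (hf : AnalyticOnNhd ℂ f (bernsteinInterior R)) {w : ℂ} (hw : w ∈ bernsteinInterior r) :
    (bernsteinEllipse r hr).integral (fun ξ => f ξ * (w - ξ)⁻¹) = 2 * Real.pi * I * f w := by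
  have hwR : w ∈ bernsteinInterior R := by
    obtain ⟨η, h1, hηr, hη⟩ := hw
    exact ⟨η, h1, hηr.trans hrR, hη⟩
  have hne {ξ : ℂ} (hξ : ξ ∈ (bernsteinEllipse r hr).trace) : ξ - w ≠ 0 := sub_ne_zero.2
    fun h => Set.disjoint_left.1 (disjoint_trace_bernsteinEllipse hr) hξ (h ▸ hw)
  have hdslope {z : ℂ} (hz : z ∈ bernsteinInterior R) : DifferentiableAt ℂ (dslope f w) z :=
    differentiableAt_dslope (hf w hwR) (hf z hz)
  have hsplit : EqOn (fun ξ => f ξ * (w - ξ)⁻¹)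
      (fun ξ => -f w * (ξ - w)⁻¹ - dslope f w ξ) (bernsteinEllipse r hr).trace := by
    intro ξ hξ
    have hξw := hne hξ
    simp only
    rw [dslope_of_ne _ (sub_ne_zero.1 hξw), slope_def_field, ← neg_sub ξ w, inv_neg]
    field_simp
    ring
  rw [RectJordanCurve.integral_congr hsplit, RectJordanCurve.integral_sub,
    RectJordanCurve.integral_const_mul, integral_bernsteinEllipse_inv_sub hr hw,
    integral_bernsteinEllipse_eq_zero hr hrR fun z hz => hdslope hz]
  · ring
  · exact continuousOn_const.mul ((continuousOn_id.sub continuousOn_const).inv₀ fun _ hξ => hne hξ)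
  · exact fun ξ hξ =>
      (hdslope (trace_bernsteinEllipse_subset hr hrR hξ)).continuousAt.continuousWithinAt

end BernsteinEllipse

/-! ### Analytic functions on the sphere and Cauchy transforms -/

theorem coe_mem_segmentSphere {w : ℂ} :
    (w : OnePoint ℂ) ∈ segmentSphere ↔ ∃ y : Icc (-1 : ℝ) 1, ((y : ℝ) : ℂ) = w := by
  simp [segmentSphere]

theorem isClosed_segmentSphere : IsClosed segmentSphere :=
  (isCompact_range (OnePoint.continuous_coe.comp (by fun_prop))).isClosed

theorem norm_ofReal_le_one (y : Icc (-1 : ℝ) 1) : ‖((y : ℝ) : ℂ)‖ ≤ 1 := by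
  rw [norm_real]
  exact abs_le.2 y.2

theorem norm_le_one_of_coe_mem_segmentSphere {w : ℂ} (hw : (w : OnePoint ℂ) ∈ segmentSphere) :
    ‖w‖ ≤ 1 := by
  obtain ⟨y, rfl⟩ := coe_mem_segmentSphere.1 hw
  exact norm_ofReal_le_one y

theorem mem_bernsteinInterior_of_coe_mem_segmentSphere {r : ℝ} (hr : 1 < r) {w : ℂ}
    (hw : (w : OnePoint ℂ) ∈ segmentSphere) : w ∈ bernsteinInterior r := by
  obtain ⟨y, rfl⟩ := coe_mem_segmentSphere.1 hw
  exact ofReal_mem_bernsteinInterior hr y.2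

theorem AnalyticOnSphere.mono {h : OnePoint ℂ → ℂ} {V W : Set (OnePoint ℂ)}
    (hh : AnalyticOnSphere h W) (hVW : V ⊆ W) : AnalyticOnSphere h V :=
  ⟨fun z hz => hh.1 z (hVW hz), fun hz => hh.2 (hVW hz)⟩

theorem invChart_zero : invChart 0 = OnePoint.infty := if_pos rfl

theorem invChart_of_ne_zero {w : ℂ} (hw : w ≠ 0) : invChart w = ((w⁻¹ : ℂ) : OnePoint ℂ) :=
  if_neg hw

theorem AnalyticOnSphere.tendsto_cobounded {h : OnePoint ℂ → ℂ} {V : Set (OnePoint ℂ)}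
    (hh : AnalyticOnSphere h V) (hV : OnePoint.infty ∈ V) :
    Tendsto (fun w : ℂ => h w) (cobounded ℂ) (𝓝 (h OnePoint.infty)) := by
  have hzero : Tendsto (fun w => h (invChart w)) (𝓝 0) (𝓝 (h OnePoint.infty)) := by
    simpa only [ContinuousAt, invChart_zero] using (hh.2 hV).continuousAt
  refine (hzero.comp (tendsto_inv₀_cobounded (α := ℂ))).congr' ?_
  filter_upwards [eventually_ne_cobounded (0 : ℂ)] with w hw
  simp only [Function.comp_apply, invChart_of_ne_zero (inv_ne_zero hw), inv_inv]

/-- Analyticity at `∞` is Riemann's removable singularity theorem. -/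
theorem analyticOnSphere_of_differentiableAt {h : OnePoint ℂ → ℂ} {V : Set (OnePoint ℂ)}
    (hV : IsOpen V) (hd : ∀ z : ℂ, (z : OnePoint ℂ) ∈ V → DifferentiableAt ℂ (fun w : ℂ => h w) z)
    (hinf : Tendsto (fun w : ℂ => h w) (cobounded ℂ) (𝓝 (h OnePoint.infty))) :
    AnalyticOnSphere h V := by
  refine ⟨fun z hz => ?_, fun hVinf => ?_⟩
  · exact DifferentiableOn.analyticAt (s := ((↑) : ℂ → OnePoint ℂ) ⁻¹' V)
      (fun w hw => (hd w hw).differentiableWithinAt)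
      ((hV.preimage OnePoint.continuous_coe).mem_nhds hz)
  · have hcoe : Tendsto ((↑) : ℂ → OnePoint ℂ) (cobounded ℂ) (𝓝 OnePoint.infty) := by
      rw [Metric.cobounded_eq_cocompact, ← coclosedCompact_eq_cocompact]
      exact OnePoint.tendsto_coe_infty
    have hmem : ∀ᶠ w : ℂ in 𝓝[≠] 0, ((w⁻¹ : ℂ) : OnePoint ℂ) ∈ V :=
      tendsto_inv₀_nhdsNE_zero.eventually (hcoe.eventually (hV.mem_nhds hVinf))
    refine analyticAt_of_differentiable_on_punctured_nhds_of_continuousAt ?_ ?_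
    · filter_upwards [hmem, self_mem_nhdsWithin] with w hw hw0
      have hinv : DifferentiableAt ℂ (fun w : ℂ => h ((w⁻¹ : ℂ) : OnePoint ℂ)) w :=
        (hd _ hw).comp w (differentiableAt_inv hw0)
      refine hinv.congr_of_eventuallyEq ?_
      filter_upwards [isOpen_ne.mem_nhds hw0] with v hv
      rw [invChart_of_ne_zero hv]
    · rw [continuousAt_iff_punctured_nhds, invChart_zero]
      refine (hinf.comp tendsto_inv₀_nhdsNE_zero).congr' ?_
      filter_upwards [self_mem_nhdsWithin] with w hw
      rw [invChart_of_ne_zero hw, Function.comp_apply]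

section CauchyIntegral

variable {E : Type*} [MeasurableSpace E] {μ : Measure E} {φ g : E → ℂ}

theorem differentiableAt_integral_div_sub (hφ : AEMeasurable φ μ) (hg : Integrable g μ) {w : ℂ}
    {δ : ℝ} (hδ : 0 < δ) (hw : ∀ᵐ y ∂μ, δ ≤ ‖φ y - w‖) :
    DifferentiableAt ℂ (fun z => ∫ y, g y / (φ y - z) ∂μ) w := by
  have hδ2 : 0 < δ / 2 := half_pos hδ
  have hfar : ∀ᵐ y ∂μ, ∀ z ∈ ball w (δ / 2), δ / 2 ≤ ‖φ y - z‖ := by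
    filter_upwards [hw] with y hy z hz
    have htri := norm_sub_norm_le (φ y - w) (z - w)
    rw [sub_sub_sub_cancel_right] at htri
    rw [mem_ball, dist_eq_norm] at hz
    linarith
  have hmeas (z : ℂ) : AEStronglyMeasurable (fun y => (φ y - z)⁻¹) μ :=
    (hφ.sub_const z).inv.aestronglyMeasurable
  have hint : Integrable (fun y => g y / (φ y - w)) μ := by
    simp only [div_eq_mul_inv]
    refine hg.mul_bdd (c := δ⁻¹) (hmeas w) ?_
    filter_upwards [hw] with y hy
    rw [norm_inv]
    gcongr
  refine (hasDerivAt_integral_of_dominated_loc_of_deriv_le (𝕜 := ℂ) (μ := μ)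
    (F := fun z y => g y / (φ y - z)) (F' := fun z y => g y * (φ y - z)⁻¹ ^ 2)
    (bound := fun y => ‖g y‖ * (δ / 2)⁻¹ ^ 2) (ball_mem_nhds w hδ2)
    (Eventually.of_forall fun z => ?_) hint (hg.1.mul ((hmeas w).pow 2)) ?_
    (hg.norm.mul_const _) ?_).2.differentiableAt
  · simp only [div_eq_mul_inv]
    exact hg.1.mul (hmeas z)
  · filter_upwards [hfar] with y hy z hz
    rw [norm_mul, norm_pow, norm_inv]
    have := hy z hz
    gcongr
  · filter_upwards [hfar] with y hy z hz
    have hne : φ y - z ≠ 0 := norm_pos_iff.1 (hδ2.trans_le (hy z hz))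
    refine (((hasDerivAt_id z).const_sub (φ y)).inv hne |>.const_mul (g y)).congr_deriv ?_
    simp

theorem norm_mul_integral_div_sub_le (hg : Integrable g μ) {M : ℝ} (hφ : ∀ᵐ y ∂μ, ‖φ y‖ ≤ M)
    {w : ℂ} (hw : 2 * M < ‖w‖) : ‖w * ∫ y, g y / (φ y - w) ∂μ‖ ≤ 2 * ∫ y, ‖g y‖ ∂μ := by
  rw [← integral_const_mul, ← integral_const_mul]
  refine norm_integral_le_of_norm_le (hg.norm.const_mul 2) ?_
  filter_upwards [hφ] with y hy
  have hle : ‖w‖ ≤ 2 * ‖φ y - w‖ := by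
    have := norm_sub_norm_le w (φ y)
    rw [norm_sub_rev] at this
    linarith
  have hpos : 0 < ‖φ y - w‖ := by linarith [norm_nonneg (φ y), norm_nonneg w]
  rw [norm_mul, norm_div, ← mul_div_assoc, div_le_iff₀ hpos]
  nlinarith [norm_nonneg (g y)]

end CauchyIntegral

/-- The reciprocal of the polynomial `q` as a function on the sphere, with value `0` at `∞`. -/
def invEval (q : ℂ[X]) (z : OnePoint ℂ) : ℂ := z.elim 0 fun w => (q.eval w)⁻¹

theorem measurable_invEval (q : ℂ[X]) : Measurable (invEval q) := by
  have hemb : MeasurableEmbedding ((↑) : ℂ → OnePoint ℂ) :=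
    OnePoint.isOpenEmbedding_coe.measurableEmbedding
  convert hemb.measurable_extend (g := fun w => (q.eval w)⁻¹) (g' := fun _ => (0 : ℂ))
    q.continuous.measurable.inv measurable_const
  ext z
  induction z using OnePoint.rec with
  | infty =>
    rw [Function.extend_apply' _ _ _ fun ⟨w, hw⟩ => OnePoint.coe_ne_infty w hw]
    rfl
  | coe w =>
    rw [OnePoint.coe_injective.extend_apply]
    rfl

theorem norm_invEval_le {q : ℂ[X]} {c : ℝ} (hc : 0 < c) {z : OnePoint ℂ}
    (hz : ∀ w : ℂ, w = z → c ≤ ‖q.eval w‖) : ‖invEval q z‖ ≤ c⁻¹ := by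
  induction z using OnePoint.rec with
  | infty => simpa [invEval] using hc.le
  | coe w =>
    rw [invEval, OnePoint.elim_some, norm_inv]
    exact inv_anti₀ hc (hz w rfl)

section CauchyTransform

variable {μ : Measure (Icc (-1 : ℝ) 1)} {g : Icc (-1 : ℝ) 1 → ℂ} {q : ℂ[X]}

theorem cauchyTransform_congr_ae {g' : Icc (-1 : ℝ) 1 → ℂ} (h : g =ᵐ[μ] g') :
    cauchyTransform μ g = cauchyTransform μ g' := by
  ext z
  induction z using OnePoint.rec with
  | infty => rfl
  | coe w => exact integral_congr_ae (by filter_upwards [h] with y hy; rw [hy])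

theorem differentiableAt_cauchyTransform (hg : Integrable g μ) {w : ℂ}
    (hw : (w : OnePoint ℂ) ∉ segmentSphere) :
    DifferentiableAt ℂ (fun z : ℂ => cauchyTransform μ g z) w := by
  have hcont : Continuous fun y : Icc (-1 : ℝ) 1 => ‖((y : ℝ) : ℂ) - w‖ := by fun_prop
  obtain ⟨δ, hδ, hle⟩ := isCompact_univ.exists_forall_le' hcont.continuousOn (a := 0) fun y _ =>
    norm_pos_iff.2 (sub_ne_zero.2 fun h => hw (coe_mem_segmentSphere.2 ⟨y, h⟩))
  exact differentiableAt_integral_div_sub (by fun_prop) hg hδ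
    (Eventually.of_forall fun y => hle y (mem_univ y))

theorem tendsto_mul_invEval_mul_cauchyTransform (hdeg : 0 < q.degree) (hg : Integrable g μ) :
    Tendsto (fun w : ℂ => w * (invEval q w * cauchyTransform μ g w)) (cobounded ℂ) (𝓝 0) := by
  have hinv : Tendsto (fun w : ℂ => invEval q w) (cobounded ℂ) (𝓝 0) :=
    tendsto_inv₀_cobounded.comp (tendsto_norm_atTop_iff_cobounded.1
      (q.tendsto_norm_atTop hdeg tendsto_norm_cobounded_atTop))
  have hbdd : IsBoundedUnder (· ≤ ·) (cobounded ℂ)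
      (norm ∘ fun w : ℂ => w * cauchyTransform μ g w) := by
    refine ⟨2 * ∫ y, ‖g y‖ ∂μ, eventually_map.2 ?_⟩
    filter_upwards [tendsto_norm_cobounded_atTop.eventually (eventually_gt_atTop (2 * 1 : ℝ))]
      with w hw
    exact norm_mul_integral_div_sub_le hg (Eventually.of_forall norm_ofReal_le_one) hw
  exact (hinv.zero_mul_isBoundedUnder_le hbdd).congr fun w => mul_left_comm ..

variable (hq : ∀ w : ℂ, (w : OnePoint ℂ) ∉ segmentSphere → q.eval w ≠ 0)
include hq

theorem differentiableAt_invEval_mul_cauchyTransform (hg : Integrable g μ) {w : ℂ}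
    (hw : (w : OnePoint ℂ) ∉ segmentSphere) :
    DifferentiableAt ℂ (fun z : ℂ => invEval q z * cauchyTransform μ g z) w :=
  (q.differentiable w).inv (hq w hw) |>.mul (differentiableAt_cauchyTransform hg hw)

theorem analyticOnSphere_invEval_mul_cauchyTransform (hdeg : 0 < q.degree) (hg : Integrable g μ) :
    AnalyticOnSphere (fun z => invEval q z * cauchyTransform μ g z) segmentSphereᶜ := by
  refine analyticOnSphere_of_differentiableAt isClosed_segmentSphere.isOpen_compl
    (fun z hz => differentiableAt_invEval_mul_cauchyTransform hq hg hz) ?_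
  have hzero := (tendsto_inv₀_cobounded (α := ℂ)).mul
    (tendsto_mul_invEval_mul_cauchyTransform hdeg hg)
  rw [mul_zero] at hzero
  refine (hzero.congr' ?_).trans_eq (by simp [invEval])
  filter_upwards [eventually_ne_cobounded (0 : ℂ)] with w hw
  rw [inv_mul_cancel_left₀ hw]

end CauchyTransform

theorem circleIntegral_eq_zero_of_tendsto_cobounded {Φ : ℂ → ℂ} {ρ : ℝ} (hρ : 0 < ρ)
    (hd : ∀ z, ρ ≤ ‖z‖ → DifferentiableAt ℂ Φ z)
    (ht : Tendsto (fun w => w * Φ w) (cobounded ℂ) (𝓝 0)) : ∮ z in C(0, ρ), Φ z = 0 := by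
  have hindep {ρ' : ℝ} (h : ρ ≤ ρ') : ∮ z in C(0, ρ), Φ z = ∮ z in C(0, ρ'), Φ z := by
    refine (circleIntegral_eq_of_differentiable_on_annulus_off_countable hρ h countable_empty
      (fun z hz => (hd z ?_).continuousAt.continuousWithinAt) fun z hz => hd z ?_).symm
    · simpa using hz.2
    · simpa using (notMem_subset ball_subset_closedBall hz.1.2)
  refine norm_le_zero_iff.1 (le_of_forall_pos_le_add fun ε hε => ?_)
  have hev : ∀ᶠ w in cobounded ℂ, ‖w * Φ w‖ < ε / (2 * Real.pi) :=
    ht.norm.eventually (gt_mem_nhds (by rw [norm_zero]; positivity))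
  rw [← comap_norm_atTop, eventually_comap] at hev
  obtain ⟨ρ', hsmall, hle⟩ := (hev.and (eventually_ge_atTop ρ)).exists
  have hρ' : 0 < ρ' := hρ.trans_le hle
  calc ‖∮ z in C(0, ρ), Φ z‖ = ‖∮ z in C(0, ρ'), Φ z‖ := by rw [hindep hle]
    _ ≤ 2 * Real.pi * ρ' * (ε / (2 * Real.pi) / ρ') := by
      refine circleIntegral.norm_integral_le_of_norm_le_const hρ'.le fun z hz => ?_
      have hz' : ‖z‖ = ρ' := by simpa using hz
      have := (hsmall z hz').le
      rwa [norm_mul, hz', mul_comm, ← le_div_iff₀ hρ'] at this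
    _ = 0 + ε := by field_simp; ring

/-! ### Contours separating a closed set from the segment -/

/-- The neighbourhood `U` of `F` and the contour `Γ` are a choice allowed in the definition of
the operator `𝒦'`: besides `Γ.Separates F U`, the set `U` is disjoint from `[-1, 1]` and contains
`∞` only if `F` does. -/
structure Contour.IsAdmissible (Γ : Contour) (F U : Set (OnePoint ℂ)) : Prop where
  isOpen : IsOpen U
  subset : F ⊆ U
  disjoint : Disjoint U segmentSphere
  infty_mem : OnePoint.infty ∈ U → OnePoint.infty ∈ F
  separates : Γ.Separates F U

theorem Contour.mem_trace_cons {γ : RectJordanCurve} {Γ : Contour} {ξ : ℂ} :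
    ξ ∈ Contour.trace (γ :: Γ) ↔ ξ ∈ γ.trace ∨ ξ ∈ Γ.trace := by
  simp [Contour.trace, RectJordanCurve.trace]

theorem Contour.mem_trace_singleton {γ : RectJordanCurve} {ξ : ℂ} :
    ξ ∈ Contour.trace [γ] ↔ ξ ∈ γ.trace := by
  simp [Contour.trace, RectJordanCurve.trace]

theorem Contour.index_infty (Γ : Contour) : Γ.index OnePoint.infty = 0 := rfl

theorem Contour.index_coe (Γ : Contour) (w : ℂ) :
    Γ.index w = (2 * Real.pi * I)⁻¹ * Γ.integral fun ξ => (ξ - w)⁻¹ := rfl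

theorem integral_circle_inv_sub {ρ : ℝ} (hρ : 0 < ρ) {w : ℂ} (hw : ‖w‖ < ρ) :
    (RectJordanCurve.circle ρ hρ).integral (fun ξ => (ξ - w)⁻¹) = 2 * Real.pi * I := by
  rw [RectJordanCurve.integral_circle]
  exact circleIntegral.integral_sub_inv_of_mem_ball (by simpa using hw)

section Separation

variable {r R ρ : ℝ} (hr : 1 < r) (hrR : r < R) {F : Set (OnePoint ℂ)}
  (hFR : ∀ z ∈ bernsteinInterior R, (z : OnePoint ℂ) ∉ F)
include hrR hFR

theorem coe_mem_compl_segmentSphere_diff_of_mem_trace_bernsteinEllipse {ξ : ℂ}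
    (hξ : ξ ∈ (bernsteinEllipse r hr).trace) : (ξ : OnePoint ℂ) ∈ segmentSphereᶜ \ F :=
  ⟨fun h => Set.disjoint_left.1 (disjoint_trace_bernsteinEllipse hr) hξ
    (mem_bernsteinInterior_of_coe_mem_segmentSphere hr h),
    hFR ξ (trace_bernsteinEllipse_subset hr hrR hξ)⟩

omit hrR in
theorem subset_compl_segmentSphere (hR : 1 < R) : F ⊆ segmentSphereᶜ := by
  rintro z hz ⟨y, rfl⟩
  exact hFR _ (ofReal_mem_bernsteinInterior hR y.2) hz

theorem isAdmissible_bernsteinEllipse (hinf : OnePoint.infty ∈ F) :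
    Contour.IsAdmissible [bernsteinEllipse r hr] F segmentSphereᶜ where
  isOpen := isClosed_segmentSphere.isOpen_compl
  subset := subset_compl_segmentSphere hFR (hr.trans hrR)
  disjoint := disjoint_compl_left
  infty_mem _ := hinf
  separates := by
    refine ⟨fun ξ hξ => ?_, -1, fun z hz => ?_, fun z hz => ?_⟩
    · exact coe_mem_compl_segmentSphere_diff_of_mem_trace_bernsteinEllipse hr hrR hFR
        (Contour.mem_trace_singleton.1 hξ)
    · induction z using OnePoint.rec with
      | infty => simp [Contour.index_infty]
      | coe w =>
        simp [Contour.index_coe,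
          integral_bernsteinEllipse_inv_sub_of_notMem hr hrR fun hw => hFR w hw hz]
    · obtain ⟨y, rfl⟩ := not_not.1 hz
      rw [Contour.index_coe, Contour.integral_cons, Contour.integral_nil, add_zero,
        integral_bernsteinEllipse_inv_sub hr (ofReal_mem_bernsteinInterior hr y.2), mul_neg,
        inv_mul_cancel₀ two_pi_I_ne_zero, Int.cast_neg, Int.cast_one]

theorem isAdmissible_bernsteinEllipse_circle (hρ : 1 < ρ) (hinf : OnePoint.infty ∉ F)
    (hFρ : ∀ w : ℂ, (w : OnePoint ℂ) ∈ F → ‖w‖ < ρ) :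
    Contour.IsAdmissible [bernsteinEllipse r hr, .circle ρ (by positivity)] F
      (segmentSphereᶜ ∩ {OnePoint.infty}ᶜ) where
  isOpen := isClosed_segmentSphere.isOpen_compl.inter isOpen_compl_singleton
  subset z hz := ⟨subset_compl_segmentSphere hFR (hr.trans hrR) hz, fun h => hinf (h ▸ hz)⟩
  disjoint := disjoint_compl_left.mono_left inter_subset_left
  infty_mem h := absurd rfl h.2
  separates := by
    have hρ0 : 0 < ρ := by positivity
    refine ⟨fun ξ hξ => ?_, 0, fun z hz => ?_, fun z hz => ?_⟩
    · suffices h : (ξ : OnePoint ℂ) ∈ segmentSphereᶜ \ F from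
        ⟨⟨h.1, OnePoint.coe_ne_infty ξ⟩, h.2⟩
      rcases Contour.mem_trace_cons.1 hξ with hξ | hξ
      · exact coe_mem_compl_segmentSphere_diff_of_mem_trace_bernsteinEllipse hr hrR hFR hξ
      · have hnorm : ‖ξ‖ = ρ := mem_sphere_zero_iff_norm.1
          (RectJordanCurve.trace_circle_subset hρ0 (Contour.mem_trace_singleton.1 hξ))
        exact ⟨fun h => (norm_le_one_of_coe_mem_segmentSphere h).not_gt (hnorm ▸ hρ),
          fun h => (hFρ ξ h).ne hnorm⟩
    · induction z using OnePoint.rec with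
      | infty => exact absurd hz hinf
      | coe w =>
        rw [Contour.index_coe, Contour.integral_cons, Contour.integral_cons,
          integral_bernsteinEllipse_inv_sub_of_notMem hr hrR fun hw => hFR w hw hz,
          integral_circle_inv_sub hρ0 (hFρ w hz), Contour.integral_nil, zero_add, add_zero,
          inv_mul_cancel₀ two_pi_I_ne_zero, Int.cast_zero, zero_add]
    · induction z using OnePoint.rec with
      | infty => simp [Contour.index_infty]
      | coe w =>
        have hw : (w : OnePoint ℂ) ∈ segmentSphere :=
          not_not.1 fun h => hz ⟨h, OnePoint.coe_ne_infty w⟩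
        rw [Contour.index_coe, Contour.integral_cons, Contour.integral_cons,
          integral_bernsteinEllipse_inv_sub hr
            (mem_bernsteinInterior_of_coe_mem_segmentSphere hr hw),
          integral_circle_inv_sub hρ0 ((norm_le_one_of_coe_mem_segmentSphere hw).trans_lt hρ),
          Contour.integral_nil, add_zero, neg_add_cancel, mul_zero, Int.cast_zero]

theorem exists_isAdmissible_integral_eq (hF : IsClosed F) :
    ∃ (U : Set (OnePoint ℂ)) (Γ : Contour), Γ.IsAdmissible F U ∧ ∀ f : ℂ → ℂ,
      (∀ w : ℂ, (w : OnePoint ℂ) ∉ F → (w : OnePoint ℂ) ∉ segmentSphere →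
        DifferentiableAt ℂ f w) →
      (OnePoint.infty ∉ F → Tendsto (fun w => w * f w) (cobounded ℂ) (𝓝 0)) →
      Γ.integral f = (bernsteinEllipse r hr).integral f := by
  by_cases hinf : OnePoint.infty ∈ F
  · exact ⟨_, _, isAdmissible_bernsteinEllipse hr hrR hFR hinf, fun f _ _ => by simp⟩
  obtain ⟨ρ₀, hρ₀⟩ := ((OnePoint.isClosed_iff_of_notMem hinf).1 hF).2.isBounded.exists_norm_le
  obtain ⟨ρ, hρ⟩ := exists_gt (max ρ₀ 1)
  obtain ⟨hρ₀ρ, hρ1⟩ := max_lt_iff.1 hρ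
  have hFρ (w : ℂ) (hw : (w : OnePoint ℂ) ∈ F) : ‖w‖ < ρ := (hρ₀ w hw).trans_lt hρ₀ρ
  refine ⟨_, _, isAdmissible_bernsteinEllipse_circle hr hrR hFR hρ1 hinf hFρ, fun f hd ht => ?_⟩
  have hcircle : (RectJordanCurve.circle ρ (by positivity)).integral f = 0 := by
    rw [RectJordanCurve.integral_circle]
    refine circleIntegral_eq_zero_of_tendsto_cobounded (by positivity) (fun w hw => ?_) (ht hinf)
    exact hd w (fun h => (hFρ w h).not_ge hw) fun h =>
      (norm_le_one_of_coe_mem_segmentSphere h).not_gt (hρ1.trans_le hw)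
  rw [Contour.integral_cons, Contour.integral_cons, hcircle, Contour.integral_nil, add_zero,
    add_zero]

end Separation

/-! ### Kernel operators -/

section KernelOperator

variable {D E : Type*} [TopologicalSpace D] [CompactSpace D]
  [MeasurableSpace D] [BorelSpace D] [TopologicalSpace E] [CompactSpace E]
  [SecondCountableTopology E] [MeasurableSpace E] [BorelSpace E]
  (lam : Measure D) [IsFiniteMeasure lam] (μ : Measure E) [IsFiniteMeasure μ]

theorem kernelOp_ae_eq (K : C(D × E, ℂ)) (g : Lp ℂ 2 μ) :
    kernelOp lam μ K g =ᵐ[lam] fun x => ∫ y, K (x, y) * g y ∂μ :=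
  ContinuousMap.coeFn_toLp lam (kernelOpC μ K g)

theorem kernelOp_sub (K₁ K₂ : C(D × E, ℂ)) :
    kernelOp lam μ (K₁ - K₂) = kernelOp lam μ K₁ - kernelOp lam μ K₂ := by
  have hsub (g : Lp ℂ 2 μ) (x : D) : ∫ y, (K₁ - K₂) (x, y) * g y ∂μ =
      ∫ y, K₁ (x, y) * g y ∂μ - ∫ y, K₂ (x, y) * g y ∂μ := by
    have hcurry : star ((K₁ - K₂).curry x) = star (K₁.curry x) - star (K₂.curry x) :=
      star_sub (K₁.curry x) (K₂.curry x)
    simp only [integral_kernel_eq_inner, hcurry, map_sub, inner_sub_left]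
  ext g : 1
  refine Lp.ext ?_
  rw [sub_apply]
  filter_upwards [kernelOp_ae_eq lam μ (K₁ - K₂) g, kernelOp_ae_eq lam μ K₁ g,
    kernelOp_ae_eq lam μ K₂ g, Lp.coeFn_sub (kernelOp lam μ K₁ g) (kernelOp lam μ K₂ g)]
    with x h h₁ h₂ hx
  rw [h, hx, Pi.sub_apply, h₁, h₂, hsub]

theorem rank_kernelOp_le_card {ι : Type*} [Fintype ι] (a : ι → C(D, ℂ)) (b : ι → C(E, ℂ))
    {K : C(D × E, ℂ)} (hK : ∀ x y, K (x, y) = ∑ i, a i x * b i y) :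
    (kernelOp lam μ K).toLinearMap.rank ≤ Fintype.card ι := by
  have hint (g : Lp ℂ 2 μ) (i : ι) : Integrable (fun y => b i y * g y) μ :=
    ((Lp.memLp g).integrable one_le_two).bdd_mul (b i).continuous.aestronglyMeasurable
      (Eventually.of_forall (b i).norm_coe_le_norm)
  have hC (g : Lp ℂ 2 μ) : kernelOpC μ K g = ∑ i, (∫ y, b i y * g y ∂μ) • a i := by
    ext x
    change ∫ y, K (x, y) * g y ∂μ = _
    simp only [hK, Finset.sum_mul, mul_assoc]
    rw [integral_finsetSum _ fun i _ => (hint g i).const_mul _]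
    simp only [ContinuousMap.sum_apply, ContinuousMap.smul_apply, smul_eq_mul,
      integral_const_mul, mul_comm]
  have hle : (kernelOp lam μ K).toLinearMap.range ≤
      Submodule.span ℂ (range fun i => ContinuousMap.toLp 2 lam ℂ (a i)) := by
    rintro - ⟨g, rfl⟩
    change ContinuousMap.toLp 2 lam ℂ (kernelOpC μ K g) ∈ _
    rw [hC, map_sum]
    refine Submodule.sum_mem _ fun i _ => ?_
    rw [map_smul]
    exact Submodule.smul_mem _ _ (Submodule.subset_span (mem_range_self i))
  refine (Submodule.rank_mono hle).trans ((rank_span_le _).trans ?_)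
  simpa using Cardinal.mk_range_le_lift (f := fun i => ContinuousMap.toLp 2 lam ℂ (a i))

end KernelOperator

section LagrangeKernel

variable {D : Type*} [TopologicalSpace D] {ι : Type*} [Fintype ι] [DecidableEq ι]

/-- The interpolation of a kernel in its second variable at the nodes `v i`: for fixed `x`, it is
the Lagrange interpolation polynomial of `K (x, ·)`. -/
def lagrangeKernel (v : ι → Icc (-1 : ℝ) 1) (K : C(D × Icc (-1 : ℝ) 1, ℂ)) :
    C(D × Icc (-1 : ℝ) 1, ℂ) where
  toFun p := (Lagrange.interpolate Finset.univ (fun i => ((v i : ℝ) : ℂ))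
    fun i => K (p.1, v i)).eval ((p.2 : ℝ) : ℂ)
  continuous_toFun := by
    simp only [eval_interpolate_eq_sum]
    fun_prop

theorem lagrangeKernel_apply (v : ι → Icc (-1 : ℝ) 1) (K : C(D × Icc (-1 : ℝ) 1, ℂ)) (x : D)
    (y : Icc (-1 : ℝ) 1) :
    lagrangeKernel v K (x, y) = (Lagrange.interpolate Finset.univ (fun i => ((v i : ℝ) : ℂ))
      fun i => K (x, v i)).eval ((y : ℝ) : ℂ) := rfl

theorem rank_kernelOp_lagrangeKernel_le [CompactSpace D]
    [MeasurableSpace D] [BorelSpace D] (lam : Measure D) [IsFiniteMeasure lam]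
    (μ : Measure (Icc (-1 : ℝ) 1)) [IsFiniteMeasure μ] (v : ι → Icc (-1 : ℝ) 1)
    (K : C(D × Icc (-1 : ℝ) 1, ℂ)) :
    (kernelOp lam μ (lagrangeKernel v K)).toLinearMap.rank ≤ Fintype.card ι := by
  refine rank_kernelOp_le_card lam μ (fun i => ⟨fun x => K (x, v i), by fun_prop⟩)
    (fun i => ⟨fun y => (Lagrange.basis Finset.univ (fun i => ((v i : ℝ) : ℂ)) i).eval
      ((y : ℝ) : ℂ), by fun_prop⟩) fun x y => ?_
  rw [lagrangeKernel_apply, eval_interpolate_eq_sum]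
  rfl

end LagrangeKernel

theorem exists_lp_ae_eq_mul {α : Type*} [MeasurableSpace α] {ν : Measure α} {p : ℝ≥0∞}
    {m : α → ℂ} (hm : AEStronglyMeasurable m ν) {c : ℝ} (hc : ∀ᵐ z ∂ν, ‖m z‖ ≤ c)
    (u : Lp ℂ p ν) : ∃ f : Lp ℂ p ν, f =ᵐ[ν] (fun z => m z * u z) ∧ ‖f‖ ≤ c * ‖u‖ := by
  have hle : ∀ᵐ z ∂ν, ‖m z * u z‖ ≤ c * ‖u z‖ := by
    filter_upwards [hc] with z hz
    rw [norm_mul]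
    gcongr
  have hmem : MemLp (fun z => m z * u z) p ν :=
    (Lp.memLp u).of_le_mul (hm.mul (Lp.aestronglyMeasurable u)) hle
  refine ⟨hmem.toLp _, hmem.coeFn_toLp, Lp.norm_le_mul_norm_of_ae_le_mul ?_⟩
  filter_upwards [hmem.coeFn_toLp, hle] with z hz hzle
  rwa [hz]

/-! ### The remainder of polynomial interpolation -/

section Remainder

variable {r R : ℝ} (hr : 1 < r)

theorem ofReal_sub_ne_zero_of_mem_trace_bernsteinEllipse {ξ : ℂ}
    (hξ : ξ ∈ (bernsteinEllipse r hr).trace) (y : Icc (-1 : ℝ) 1) : ((y : ℝ) : ℂ) - ξ ≠ 0 :=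
  sub_ne_zero.2 fun h => Set.disjoint_left.1 (disjoint_trace_bernsteinEllipse hr) hξ
    (h ▸ ofReal_mem_bernsteinInterior hr y.2)

theorem continuousOn_mul_inv_sub_trace_bernsteinEllipse (hrR : r < R) {f : ℂ → ℂ}
    (hf : AnalyticOnNhd ℂ f (bernsteinInterior R)) (y : Icc (-1 : ℝ) 1) :
    ContinuousOn (fun ξ => f ξ * (((y : ℝ) : ℂ) - ξ)⁻¹) (bernsteinEllipse r hr).trace :=
  (hf.continuousOn.mono (trace_bernsteinEllipse_subset hr hrR)).mul
    ((continuousOn_const.sub continuousOn_id).inv₀ fun _ hξ =>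
      ofReal_sub_ne_zero_of_mem_trace_bernsteinEllipse hr hξ y)

variable {ι : Type*} [Fintype ι] {v : ι → Icc (-1 : ℝ) 1}
  (hv : Function.Injective v) {q : ℂ[X]} (hdeg : q.degree = Fintype.card ι)
  (hq : ∀ i, q.eval ((v i : ℝ) : ℂ) = 0)
include hv hdeg hq

theorem eval_ne_zero_of_notMem_segmentSphere {w : ℂ} (hw : (w : OnePoint ℂ) ∉ segmentSphere) :
    q.eval w ≠ 0 :=
  eval_ne_zero_of_forall_ne (s := Finset.univ) (v := fun i => ((v i : ℝ) : ℂ))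
    ((ofReal_injective.comp (Subtype.val_injective.comp hv)).injOn) (by simpa using hdeg)
    (fun i _ => hq i) fun i _ h => hw (coe_mem_segmentSphere.2 ⟨v i, h⟩)

theorem eval_ne_zero_of_mem_trace_bernsteinEllipse {ξ : ℂ}
    (hξ : ξ ∈ (bernsteinEllipse r hr).trace) : q.eval ξ ≠ 0 :=
  eval_ne_zero_of_notMem_segmentSphere hv hdeg hq fun h =>
    Set.disjoint_left.1 (disjoint_trace_bernsteinEllipse hr) hξ
      (mem_bernsteinInterior_of_coe_mem_segmentSphere hr h)

variable [DecidableEq ι] (hrR : r < R) {f : ℂ → ℂ}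
  (hf : AnalyticOnNhd ℂ f (bernsteinInterior R))
include hrR hf

theorem integral_bernsteinEllipse_mul_remainder (y : Icc (-1 : ℝ) 1) :
    (bernsteinEllipse r hr).integral
        (fun ξ => f ξ * (q.eval ((y : ℝ) : ℂ) / (q.eval ξ * (((y : ℝ) : ℂ) - ξ)))) =
      2 * Real.pi * I * (f ((y : ℝ) : ℂ) - (Lagrange.interpolate Finset.univ
        (fun i => ((v i : ℝ) : ℂ)) fun i => f ((v i : ℝ) : ℂ)).eval ((y : ℝ) : ℂ)) := by
  set node : ι → ℂ := fun i => ((v i : ℝ) : ℂ)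
  set ℓ : ι → ℂ := fun i => (Lagrange.basis Finset.univ node i).eval ((y : ℝ) : ℂ)
  have hcauchy (t : Icc (-1 : ℝ) 1) :
      (bernsteinEllipse r hr).integral (fun ξ => f ξ * (((t : ℝ) : ℂ) - ξ)⁻¹) =
        2 * Real.pi * I * f ((t : ℝ) : ℂ) :=
    integral_bernsteinEllipse_mul_inv_sub hr hrR hf (ofReal_mem_bernsteinInterior hr t.2)
  have hcont := continuousOn_mul_inv_sub_trace_bernsteinEllipse hr hrR hf
  have hcontℓ (i : ι) : ContinuousOn (fun ξ => ℓ i * (f ξ * (node i - ξ)⁻¹))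
      (bernsteinEllipse r hr).trace := continuousOn_const.mul (hcont (v i))
  have hsplit : EqOn
      (fun ξ => f ξ * (q.eval ((y : ℝ) : ℂ) / (q.eval ξ * (((y : ℝ) : ℂ) - ξ))))
      (fun ξ => f ξ * (((y : ℝ) : ℂ) - ξ)⁻¹ - ∑ i, ℓ i * (f ξ * (node i - ξ)⁻¹))
      (bernsteinEllipse r hr).trace := by
    intro ξ hξ
    have hinj : InjOn node (Finset.univ : Finset ι) :=
      (ofReal_injective.comp (Subtype.val_injective.comp hv)).injOn
    simp only
    rw [← inv_sub_sub_eval_interpolate hinj hdeg.le (fun i _ => hq i)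
      (eval_ne_zero_of_mem_trace_bernsteinEllipse hr hv hdeg hq hξ)
      (sub_ne_zero.1 (ofReal_sub_ne_zero_of_mem_trace_bernsteinEllipse hr hξ y)),
      eval_interpolate_eq_sum, mul_sub, Finset.mul_sum]
    exact congrArg _ (Finset.sum_congr rfl fun i _ => by ring)
  rw [RectJordanCurve.integral_congr hsplit, RectJordanCurve.integral_sub (hcont y)
    (continuousOn_finsetSum _ fun i _ => hcontℓ i),
    RectJordanCurve.integral_finsetSum _ fun i _ => hcontℓ i, eval_interpolate_eq_sum]
  simp only [RectJordanCurve.integral_const_mul, node, hcauchy]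
  rw [mul_sub, Finset.mul_sum]
  exact congrArg _ (Finset.sum_congr rfl fun i _ => by ring)

theorem integral_bernsteinEllipse_mul_invEval_mul_cauchyTransform {μ : Measure (Icc (-1 : ℝ) 1)}
    [SFinite μ] {g : Icc (-1 : ℝ) 1 → ℂ} (hg : Integrable g μ) :
    (bernsteinEllipse r hr).integral (fun ξ => f ξ *
        (invEval q ξ * cauchyTransform μ (fun y => q.eval ((y : ℝ) : ℂ) * g y) ξ)) =
      2 * Real.pi * I * ∫ y : Icc (-1 : ℝ) 1, (f ((y : ℝ) : ℂ) -
        (Lagrange.interpolate Finset.univ (fun i => ((v i : ℝ) : ℂ))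
          fun i => f ((v i : ℝ) : ℂ)).eval ((y : ℝ) : ℂ)) * g y ∂μ := by
  have hker : ContinuousOn (Function.uncurry fun ξ (y : Icc (-1 : ℝ) 1) =>
      f ξ * (q.eval ((y : ℝ) : ℂ) / (q.eval ξ * (((y : ℝ) : ℂ) - ξ))))
      ((bernsteinEllipse r hr).trace ×ˢ univ) := by
    refine ((hf.continuousOn.mono (trace_bernsteinEllipse_subset hr hrR)).comp continuousOn_fst
      fun z hz => hz.1).mul (ContinuousOn.div (by fun_prop) (by fun_prop) fun z hz => ?_)
    exact mul_ne_zero (eval_ne_zero_of_mem_trace_bernsteinEllipse hr hv hdeg hq hz.1)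
      (ofReal_sub_ne_zero_of_mem_trace_bernsteinEllipse hr hz.1 z.2)
  have hmoved (ξ : ℂ) : f ξ *
      (invEval q ξ * cauchyTransform μ (fun y => q.eval ((y : ℝ) : ℂ) * g y) ξ) =
      ∫ y : Icc (-1 : ℝ) 1,
        f ξ * (q.eval ((y : ℝ) : ℂ) / (q.eval ξ * (((y : ℝ) : ℂ) - ξ))) * g y ∂μ := by
    simp only [invEval, cauchyTransform, OnePoint.elim_some]
    rw [← integral_const_mul, ← integral_const_mul]
    refine integral_congr_ae (Eventually.of_forall fun y => ?_)
    simp only [div_eq_mul_inv, mul_inv]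
    ring
  simp only [hmoved]
  rw [RectJordanCurve.integral_integral_swap hker hg, ← integral_const_mul]
  simp only [integral_bernsteinEllipse_mul_remainder hr hv hdeg hq hrR hf, mul_assoc]

end Remainder

/-! ### The error bound -/

section ErrorBound

variable {D : Type*} [TopologicalSpace D] [MeasurableSpace D] {lam : Measure D}
  {μ : Measure (Icc (-1 : ℝ) 1)} {R : ℝ} {F : Set (OnePoint ℂ)} {ν : Measure F}
  {p : ℝ≥0∞} [Fact (1 ≤ p)]
  {K : C(D × Icc (-1 : ℝ) 1, ℂ)} {Kext : D → OnePoint ℂ → ℂ} {ι : Type*} [Fintype ι]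
  [Nonempty ι] {v : ι → Icc (-1 : ℝ) 1} {q : ℂ[X]}

theorem degree_pos_of_degree_eq_card (hdeg : q.degree = Fintype.card ι) : 0 < q.degree := by
  rw [hdeg]
  exact_mod_cast Fintype.card_pos

theorem representsOn_invEval_mul_cauchyTransform {U : Set (OnePoint ℂ)} {g : Icc (-1 : ℝ) 1 → ℂ}
    (hU : IsOpen U) (hFU : F ⊆ U) (hUs : U ⊆ segmentSphereᶜ)
    (hq : ∀ w : ℂ, (w : OnePoint ℂ) ∉ segmentSphere → q.eval w ≠ 0) (hdeg : 0 < q.degree)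
    (hg : Integrable g μ) :
    RepresentsOn F U fun z => invEval q z * cauchyTransform μ g z where
  isOpen := hU
  subset := hFU
  analytic := (analyticOnSphere_invEval_mul_cauchyTransform hq hdeg hg).mono hUs
  vanish _ := zero_mul _

theorem RepresentsOn.mem_bergman {U : Set (OnePoint ℂ)} {h : OnePoint ℂ → ℂ} {f : Lp ℂ p ν}
    (hrep : RepresentsOn F U h) (hf : f =ᵐ[ν] fun z : F => h z) : f ∈ bergman p ν :=
  Submodule.le_topologicalClosure _ ⟨U, h, hrep, hf⟩

variable (hR : 1 < R) (hFR : ∀ z ∈ bernsteinInterior R, (z : OnePoint ℂ) ∉ F)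
  (hv : Function.Injective v) (hdeg : q.degree = Fintype.card ι)
  (hq : ∀ i, q.eval ((v i : ℝ) : ℂ) = 0)
  (hext : ∀ (x : D) (y : Icc (-1 : ℝ) 1), Kext x (((y : ℝ) : ℂ) : OnePoint ℂ) = K (x, y))
  (hanal : ∀ x, AnalyticOnSphere (Kext x) Fᶜ)
include hR hFR hv hdeg hq hext hanal

theorem IsDualOp.apply_ae_eq_of_ae_eq [SFinite μ] [DecidableEq ι] (hF : IsClosed F)
    {T : bergman p ν →L[ℂ] Lp ℂ 2 lam} (hT : IsDualOp Kext lam p ν T)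
    {g : Icc (-1 : ℝ) 1 → ℂ} (hg : Integrable g μ) {f : bergman p ν}
    (hf : (f : Lp ℂ p ν) =ᵐ[ν] fun z : F => invEval q z *
      cauchyTransform μ (fun y => q.eval ((y : ℝ) : ℂ) * g y) z) :
    T f =ᵐ[lam] fun x => ∫ y, (K - lagrangeKernel v K) (x, y) * g y ∂μ := by
  have hq0 (w : ℂ) (hw : (w : OnePoint ℂ) ∉ segmentSphere) : q.eval w ≠ 0 :=
    eval_ne_zero_of_notMem_segmentSphere hv hdeg hq hw
  have hdeg0 := degree_pos_of_degree_eq_card hdeg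
  have hqg : Integrable (fun y : Icc (-1 : ℝ) 1 => q.eval ((y : ℝ) : ℂ) * g y) μ := by
    let φ : C(Icc (-1 : ℝ) 1, ℂ) := ⟨fun y => q.eval ((y : ℝ) : ℂ), by fun_prop⟩
    exact hg.bdd_mul φ.continuous.aestronglyMeasurable (Eventually.of_forall φ.norm_coe_le_norm)
  obtain ⟨r, hr, hrR⟩ := exists_between hR
  obtain ⟨U, Γ, hΓ, hdeform⟩ := exists_isAdmissible_integral_eq hr hrR hFR hF
  have hrep := representsOn_invEval_mul_cauchyTransform hΓ.isOpen hΓ.subset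
    (subset_compl_iff_disjoint_right.2 hΓ.disjoint) hq0 hdeg0 hqg
  refine (hT U _ Γ f hrep hΓ.disjoint hΓ.infty_mem hΓ.separates hf).trans
    (Eventually.of_forall fun x => ?_)
  have hellipse := hdeform (fun ξ => Kext x ξ * (invEval q ξ *
      cauchyTransform μ (fun y => q.eval ((y : ℝ) : ℂ) * g y) ξ))
    (fun w hwF hw => ((hanal x).1 w hwF).differentiableAt.mul
      (differentiableAt_invEval_mul_cauchyTransform hq0 hqg hw)) fun hinf => by
    have := ((hanal x).tendsto_cobounded hinf).mul
      (tendsto_mul_invEval_mul_cauchyTransform hdeg0 hqg)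
    rw [mul_zero] at this
    exact this.congr fun w => mul_left_comm ..
  simp only
  rw [hellipse, integral_bernsteinEllipse_mul_invEval_mul_cauchyTransform hr hv hdeg hq hrR
    (fun z hz => (hanal x).1 z (hFR z hz)) hg, inv_mul_cancel_left₀ two_pi_I_ne_zero]
  simp only [hext]
  rfl

theorem norm_kernelOp_sub_lagrangeKernel_le [CompactSpace D] [BorelSpace D] [IsFiniteMeasure lam]
    [IsFiniteMeasure μ] [DecidableEq ι] (hF : IsClosed F) {A c : ℝ}
    (hA : ∀ y : Icc (-1 : ℝ) 1, ‖q.eval ((y : ℝ) : ℂ)‖ ≤ A) (hc : 0 < c)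
    (hcF : ∀ z ∉ bernsteinInterior R, c ≤ ‖q.eval z‖)
    {S : Lp ℂ 2 μ →L[ℂ] Lp ℂ p ν} (hS : IsCauchyOp μ p ν S)
    {T : bergman p ν →L[ℂ] Lp ℂ 2 lam} (hT : IsDualOp Kext lam p ν T) :
    ‖kernelOp lam μ K - kernelOp lam μ (lagrangeKernel v K)‖ ≤ A / c * ‖S‖ * ‖T‖ := by
  have hA0 : 0 ≤ A := (norm_nonneg _).trans (hA ⟨0, by norm_num⟩)
  have hinv (z : F) : ‖invEval q z‖ ≤ c⁻¹ :=
    norm_invEval_le hc fun w hw => hcF w fun hwR => hFR w hwR (hw ▸ z.2)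
  rw [← kernelOp_sub]
  refine ContinuousLinearMap.opNorm_le_bound _ (by positivity) fun g => ?_
  have hg : Integrable g μ := (Lp.memLp g).integrable one_le_two
  obtain ⟨u, hu, hug⟩ := exists_lp_ae_eq_mul
    (m := fun y : Icc (-1 : ℝ) 1 => q.eval ((y : ℝ) : ℂ))
    (Continuous.aestronglyMeasurable (by fun_prop)) (Eventually.of_forall hA) g
  obtain ⟨f, hf, hfS⟩ := exists_lp_ae_eq_mul (m := fun z : F => invEval q z)
    ((measurable_invEval q).comp measurable_subtype_coe).aestronglyMeasurable
    (Eventually.of_forall hinv) (S u)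
  have hfC : f =ᵐ[ν] fun z : F => invEval q z *
      cauchyTransform μ (fun y => q.eval ((y : ℝ) : ℂ) * g y) z := by
    filter_upwards [hf, hS u] with z hz hSz
    rw [hz, hSz, cauchyTransform_congr_ae hu]
  have hfmem : f ∈ bergman p ν :=
    (representsOn_invEval_mul_cauchyTransform isClosed_segmentSphere.isOpen_compl
      (subset_compl_segmentSphere hFR hR) Subset.rfl
      (fun w => eval_ne_zero_of_notMem_segmentSphere hv hdeg hq)
      (degree_pos_of_degree_eq_card hdeg)
      (((Lp.memLp u).integrable one_le_two).congr hu)).mem_bergman hfC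
  have hfactor : kernelOp lam μ (K - lagrangeKernel v K) g = T ⟨f, hfmem⟩ :=
    Lp.ext ((kernelOp_ae_eq lam μ _ g).trans (IsDualOp.apply_ae_eq_of_ae_eq hR hFR hv hdeg hq
      hext hanal hF hT hg hfC).symm)
  calc ‖kernelOp lam μ (K - lagrangeKernel v K) g‖ = ‖T ⟨f, hfmem⟩‖ := by rw [hfactor]
    _ ≤ ‖T‖ * (c⁻¹ * (‖S‖ * (A * ‖g‖))) := by
      refine (T.le_opNorm _).trans ?_
      gcongr
      refine hfS.trans ?_
      gcongr
      exact (S.le_opNorm u).trans (by gcongr)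
    _ = A / c * ‖S‖ * ‖T‖ * ‖g‖ := by ring

end ErrorBound

theorem le_mul_toReal_iInf_enorm {V : Type*} [SeminormedAddCommGroup V] {P : V → Prop} {a k : ℝ}
    (hk : 0 ≤ k) (h : ∀ T, P T → a ≤ k * ‖T‖) (htop : (⨅ (T : V) (_ : P T), ‖T‖ₑ) ≠ ⊤) :
    a ≤ k * (⨅ (T : V) (_ : P T), ‖T‖ₑ).toReal := by
  rcases hk.eq_or_lt with rfl | hk
  · obtain ⟨T, hT⟩ := iInf_lt_iff.1 htop.lt_top
    obtain ⟨hP, -⟩ := iInf_lt_iff.1 hT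
    simpa using h T hP
  · by_contra! hlt
    rw [← lt_div_iff₀' hk, ← ENNReal.lt_ofReal_iff_toReal_lt htop] at hlt
    obtain ⟨T, hT⟩ := iInf_lt_iff.1 hlt
    obtain ⟨hP, hT⟩ := iInf_lt_iff.1 hT
    rw [ENNReal.lt_ofReal_iff_toReal_lt enorm_ne_top, toReal_enorm, lt_div_iff₀' hk] at hT
    exact absurd (h T hP) (not_le.2 hT)

theorem le_mul_toReal_cauchyNorm_mul_toReal_dualNorm {D : Type*} [MeasurableSpace D]
    {lam : Measure D} {μ : Measure (Icc (-1 : ℝ) 1)} {F : Set (OnePoint ℂ)} {ν : Measure F}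
    {p : ℝ≥0∞} [Fact (1 ≤ p)] {Kext : D → OnePoint ℂ → ℂ} {a k : ℝ} (hk : 0 ≤ k)
    (h : ∀ S T, IsCauchyOp μ p ν S → IsDualOp Kext lam p ν T → a ≤ k * ‖S‖ * ‖T‖)
    (hC : cauchyNorm μ p ν ≠ ⊤) (hK : dualNorm Kext lam p ν ≠ ⊤) :
    a ≤ k * (cauchyNorm μ p ν).toReal * (dualNorm Kext lam p ν).toReal := by
  refine le_mul_toReal_iInf_enorm (by positivity) (fun T hT => ?_) hK
  rw [mul_right_comm]
  refine le_mul_toReal_iInf_enorm (by positivity) (fun S hS => ?_) hC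
  rw [mul_right_comm]
  exact h S T hS hT

theorem pow_sub_inv_pow_pos {R : ℝ} (hR : 1 < R) {n : ℕ} (hn : n ≠ 0) :
    0 < R ^ n - (R ^ n)⁻¹ :=
  sub_pos.2 ((inv_lt_one_of_one_lt₀ (one_lt_pow₀ hR hn)).trans (one_lt_pow₀ hR hn))

theorem two_mul_zpow_neg_div_one_sub_zpow {R : ℝ} (hR : R ≠ 0) (n : ℕ) :
    2 * R ^ (-(n : ℤ)) / (1 - R ^ (-(2 * n : ℤ))) = 1 / ((R ^ n - (R ^ n)⁻¹) / 2) := by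
  have hRn : R ^ n ≠ 0 := pow_ne_zero n hR
  have hsq : R ^ (-(2 * n : ℤ)) = (R ^ n)⁻¹ * (R ^ n)⁻¹ := by
    rw [two_mul, neg_add, zpow_add₀ hR, zpow_neg, zpow_natCast]
  have hden : 1 - (R ^ n)⁻¹ * (R ^ n)⁻¹ = (R ^ n)⁻¹ * (R ^ n - (R ^ n)⁻¹) := by
    field_simp
  rw [hsq, hden, zpow_neg, zpow_natCast, mul_comm 2, mul_div_mul_left _ _ (inv_ne_zero hRn),
    one_div_div]

end LowRank

end

theorem mainTheorem4_general
    {D : Type*} [TopologicalSpace D] [CompactSpace D] [MeasurableSpace D] [BorelSpace D]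
    (K : C(D × Icc (-1 : ℝ) 1, ℂ)) (n : ℕ) (hn : 1 ≤ n) :
    ∃ Kn : C(D × Icc (-1 : ℝ) 1, ℂ),
      ∀ (lam : Measure D) [IsFiniteMeasure lam] (μ : Measure (Icc (-1 : ℝ) 1)) [IsFiniteMeasure μ],
        (LowRank.kernelOp lam μ Kn).toLinearMap.rank ≤ n ∧
        ∀ (R : ℝ), 1 < R → ∀ (F : Set (OnePoint ℂ)), IsClosed F →
        (∀ z ∈ LowRank.bernsteinInterior R, (z : OnePoint ℂ) ∉ F) →
        ∀ (ν : Measure F) (Kext : D → OnePoint ℂ → ℂ),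
        (∀ (x : D) (y : Icc (-1 : ℝ) 1), Kext x (((y : ℝ) : ℂ) : OnePoint ℂ) = K (x, y)) →
        (∀ x, LowRank.AnalyticOnSphere (Kext x) Fᶜ) →
        ∀ (p : ℝ≥0∞) [Fact (1 ≤ p)],
          LowRank.cauchyNorm μ p ν ≠ ⊤ → LowRank.dualNorm Kext lam p ν ≠ ⊤ →
          ‖LowRank.kernelOp lam μ K - LowRank.kernelOp lam μ Kn‖ ≤
            2 * R ^ (-(n : ℤ)) / (1 - R ^ (-(2 * n : ℤ))) *
              (LowRank.cauchyNorm μ p ν).toReal * (LowRank.dualNorm Kext lam p ν).toReal := by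
  have : NeZero n := ⟨Nat.one_le_iff_ne_zero.1 hn⟩
  have hdeg : (Polynomial.Chebyshev.T ℂ n).degree = Fintype.card (Fin n) := by
    rw [Polynomial.Chebyshev.degree_T, Int.natAbs_natCast, Fintype.card_fin]
  refine ⟨LowRank.lagrangeKernel (LowRank.chebyshevNode n) K, fun lam _ μ _ => ⟨?_, ?_⟩⟩
  · simpa using LowRank.rank_kernelOp_lagrangeKernel_le lam μ (LowRank.chebyshevNode n) K
  intro R hR F hF hFR ν Kext hext hanal p _ hC hK
  have hpos := half_pos (LowRank.pow_sub_inv_pow_pos hR (NeZero.ne n))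
  rw [LowRank.two_mul_zpow_neg_div_one_sub_zpow (by positivity)]
  exact LowRank.le_mul_toReal_cauchyNorm_mul_toReal_dualNorm (by positivity) (fun S T hS hT =>
    LowRank.norm_kernelOp_sub_lagrangeKernel_le hR hFR (LowRank.chebyshevNode_injective n) hdeg
      (LowRank.eval_chebyshevT_node n) hext hanal hF (LowRank.norm_eval_chebyshevT_le_one n) hpos
      (fun z => LowRank.le_norm_eval_chebyshevT n hR) hS hT) hC hK

theorem mainTheorem4
    {D : Type*} [MetricSpace D] [CompactSpace D] [MeasurableSpace D] [BorelSpace D]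
    (lam : Measure D) [IsFiniteMeasure lam]
    (μ : Measure (Icc (-1 : ℝ) 1)) [IsFiniteMeasure μ]
    (R : ℝ) (hR : 1 < R)
    (F : Set (OnePoint ℂ)) (hF : IsClosed F)
    (hFR : ∀ z ∈ LowRank.bernsteinInterior R, (z : OnePoint ℂ) ∉ F)
    (ν : Measure F)
    (K : C(D × Icc (-1 : ℝ) 1, ℂ)) (Kext : D → OnePoint ℂ → ℂ)
    (hext : ∀ (x : D) (y : Icc (-1 : ℝ) 1), Kext x (((y : ℝ) : ℂ) : OnePoint ℂ) = K (x, y))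
    (hcont : ContinuousOn (fun q : D × OnePoint ℂ => Kext q.1 q.2) (univ ×ˢ Fᶜ))
    (hanal : ∀ x, LowRank.AnalyticOnSphere (Kext x) Fᶜ)
    (n : ℕ) (hn : 1 ≤ n) :
    ∃ Kn : C(D × Icc (-1 : ℝ) 1, ℂ),
      (LowRank.kernelOp lam μ Kn).toLinearMap.rank ≤ n ∧
      ∀ (p : ℝ≥0∞) [Fact (1 ≤ p)],
        LowRank.cauchyNorm μ p ν ≠ ⊤ → LowRank.dualNorm Kext lam p ν ≠ ⊤ →
        ‖LowRank.kernelOp lam μ K - LowRank.kernelOp lam μ Kn‖ ≤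
          2 * R ^ (-(n : ℤ)) / (1 - R ^ (-(2 * n : ℤ))) *
            (LowRank.cauchyNorm μ p ν).toReal * (LowRank.dualNorm Kext lam p ν).toReal := by
  obtain ⟨Kn, hKn⟩ := mainTheorem4_general K n hn
  exact ⟨Kn, (hKn lam μ).1, (hKn lam μ).2 R hR F hF hFR ν Kext hext hanal⟩
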